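/- Let $G$ be a finite-dimensional real Lie group with Lie algebra $\mathfrak g=T_{e}G$, let $g$ be an inner product on $\mathfrak g$, and equip $G$ with the left-invariant Riemannian metric determined by $g$, i.e. $g_p(pv,pw)=g(v,w)$ for $p\in G$ and $v,w\in\mathfrak g$, where $pv\in T_pG$ denotes the image of $v$ under the differential of left multiplication by $p$. For $u\in\mathfrak g$ let $\mathrm{ad}^\star_u$ be the $g$-adjoint of $\mathrm{ad}_u$: $g(\mathrm{ad}^\star_u v,w)=g(v,[u,w])$ for all $v,w\in\mathfrak g$. A curve $\gamma$ in $G$, defined on an interval, is a geodesic with Lie-algebra velocity $u(t)=\gamma(t)^{-1}\gamma'(t)$ if $$\gamma'(t)=\gamma(t)u(t),\qquad u'(t)=\mathrm{ad}^\star_{u(t)}u(t).$$ For $p\in G$ let $\exp_p\colon T_pG\to G$ be the Riemannian exponential map: $\exp_p(v)=\eta(1)$, where $\eta$ is the geodesic with $\eta(0)=p$ and $\eta'(0)=v$. For a geodesic $\gamma$ and $\tau>0$, the point $\gamma(\tau)=\exp_{\gamma(0)}(\tau\gamma'(0))$ is said to be conjugate to $\gamma(0)$ (along $\gamma$) if the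 differential of $\exp_{\gamma(0)}$ at $\tau\gamma'(0)$ is a singular linear map. **Theorem.** Let $\gamma$ be a geodesic defined on an interval $J\subseteq\mathbb R$ with $0\in J$, whose Lie-algebra velocity $u(t)$ is nonconstant on $J$, and let $\tau\in J$ with $\tau>0$. If right multiplication by $\gamma(0)^{-1}\gamma(\tau)$ is an isometry of the left-invariant metric, then $\gamma(\tau)$ is conjugate to $\gamma(0)$ along $\gamma$. In particular, if $\gamma(\tau)=\gamma(0)$, then $\gamma(\tau)$ is conjugate to $\gamma(0)$ along $\gamma$. -/

import Mathlib

open Set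
open scoped Manifold ContDiff

noncomputable section

namespace LeftInvariant

section

variable {E : Type*} [NormedAddCommGroup E] [NormedSpace ℝ E]
  {H : Type*} [TopologicalSpace H] {I : ModelWithCorners ℝ E H}
  {G : Type*} [TopologicalSpace G] [ChartedSpace H G] [Group G]

/-- A smooth Lie group is smooth enough for Mathlib's bracket on its Lie algebra
`GroupLieAlgebra I G` (the tangent space at `1`) to be a Lie algebra structure. -/
instance lieGroup_minSmoothness_three [LieGroup I ∞ G] : LieGroup I (minSmoothness ℝ 3) G :=
  LieGroup.of_le (n := ∞) (by simpa using (ENat.LEInfty.out (m := 3)))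

instance finiteDimensional_groupLieAlgebra [FiniteDimensional ℝ E] :
    FiniteDimensional ℝ (GroupLieAlgebra I G) :=
  inferInstanceAs (FiniteDimensional ℝ E)

/-- An inner product on the Lie algebra, regarded as a bilinear form. -/
def form (g : InnerProductSpace.Core ℝ (GroupLieAlgebra I G)) :
    LinearMap.BilinForm ℝ (GroupLieAlgebra I G) :=
  LinearMap.mk₂ ℝ g.inner g.add_left (fun c x y => g.smul_left x y c)
    (fun x y z => by
      have h : ∀ a b, g.inner b a = g.inner a b := fun a b => g.conj_inner_symm a b
      rw [← h, g.add_left, h y x, h z x])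
    (fun c x y => by
      have h : ∀ a b, g.inner b a = g.inner a b := fun a b => g.conj_inner_symm a b
      rw [← h, g.smul_left, h y x]; rfl)

lemma form_apply (g : InnerProductSpace.Core ℝ (GroupLieAlgebra I G))
    (x y : GroupLieAlgebra I G) : form g x y = g.inner x y := rfl

lemma form_nondegenerate (g : InnerProductSpace.Core ℝ (GroupLieAlgebra I G)) :
    (form g).Nondegenerate :=
  ⟨fun x hx => g.definite x (hx x), fun x hx => g.definite x (hx x)⟩

/-- The value at `(x, y)`, for `x y ∈ T_p G`, of the left-invariant Riemannian metric on `G`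
determined by the inner product `g` on the Lie algebra: `g (p⁻¹ x) (p⁻¹ y)`. -/
def metric (g : InnerProductSpace.Core ℝ (GroupLieAlgebra I G)) (p : G)
    (x y : TangentSpace I p) : ℝ :=
  g.inner (mfderiv I I (fun q : G => p⁻¹ * q) p x) (mfderiv I I (fun q : G => p⁻¹ * q) p y)

/-- Right multiplication by `h` is an isometry of the left-invariant metric: its differential
preserves the inner products of tangent vectors. -/
def IsRightIsometry (g : InnerProductSpace.Core ℝ (GroupLieAlgebra I G)) (h : G) : Prop :=
  ∀ (p : G) (x y : TangentSpace I p),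
    metric g (p * h) (mfderiv I I (fun q : G => q * h) p x) (mfderiv I I (fun q : G => q * h) p y)
      = metric g p x y

variable [FiniteDimensional ℝ E] [LieGroup I ∞ G]

/-- The operator `ad⋆_u`, that is, the adjoint of `ad_u` for the inner product `g`. -/
def adStar (g : InnerProductSpace.Core ℝ (GroupLieAlgebra I G)) (u v : GroupLieAlgebra I G) :
    GroupLieAlgebra I G :=
  ((form g).toDual (form_nondegenerate g)).symm
    ((form g v).comp (LieAlgebra.ad ℝ (GroupLieAlgebra I G) u : Module.End ℝ _))

/-- The defining property of `ad⋆`. -/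
lemma inner_adStar (g : InnerProductSpace.Core ℝ (GroupLieAlgebra I G))
    (u v w : GroupLieAlgebra I G) : g.inner (adStar g u v) w = g.inner v ⁅u, w⁆ := by
  change form g _ w = _
  rw [adStar, LinearMap.BilinForm.apply_toDual_symm_apply]
  rfl

/-- `γ`, with left-translated velocity `u`, is a geodesic on the set `s` of times:
`γ' = γ u` (flow equation) and `u' = ad⋆_u u` (Euler-Arnold equation) hold on `s`.
At an endpoint of an interval `s` the derivatives are one-sided; the values of `γ` and `u`
outside `s` are irrelevant. -/
def IsGeodesicOn (g : InnerProductSpace.Core ℝ (GroupLieAlgebra I G))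
    (γ : ℝ → G) (u : ℝ → GroupLieAlgebra I G) (s : Set ℝ) : Prop :=
  ∀ t ∈ s,
    HasMFDerivWithinAt 𝓘(ℝ, ℝ) I γ s t
      ((1 : ℝ →L[ℝ] ℝ).smulRight (mulInvariantVectorField (u t) (γ t))) ∧
    HasDerivWithinAt u (adStar g (u t) (u t)) s t

open Classical in
/-- The Riemannian exponential map `exp_p : T_p G → G` of the left-invariant metric: `exp_p v` is
the value at time `1` of the geodesic `γ` with `γ 0 = p` and `γ' 0 = v`. Such a geodesic exists
and is unique for every `v`, since left-invariant metrics are complete; the second branch, needed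
only to make the definition total, never occurs. -/
def riemExp (g : InnerProductSpace.Core ℝ (GroupLieAlgebra I G)) (p : G)
    (v : TangentSpace I p) : G :=
  if h : ∃ (γ : ℝ → G) (u : ℝ → GroupLieAlgebra I G), IsGeodesicOn g γ u (Icc 0 1) ∧
      γ 0 = p ∧ mulInvariantVectorField (u 0) p = v then
    h.choose 1
  else p

/-- For the tangent vector `v` at `p`, the point `q` is conjugate to `p` along the geodesic
`t ↦ exp_p (t v)` at time `τ`: one has `q = exp_p (τ v)`, and the differential of `exp_p` at `τ v`
(which is required to exist) is a singular linear map. -/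
def IsConjugateAt (g : InnerProductSpace.Core ℝ (GroupLieAlgebra I G)) (p : G)
    (v : TangentSpace I p) (τ : ℝ) (q : G) : Prop :=
  riemExp g p (τ • v) = q ∧
  ∃ L : E →L[ℝ] TangentSpace I (riemExp g p (τ • v)),
    HasMFDerivAt 𝓘(ℝ, E) I (fun w : E => riemExp g p w) (τ • v : TangentSpace I p) L ∧
    ¬ Function.Injective L

/-- Along the geodesic `γ` with left-translated velocity `u`, the point `γ τ` is conjugate to
`γ 0`. Here `mulInvariantVectorField (u 0) (γ 0)` is the initial velocity `γ' 0 = γ 0 u 0`. -/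
def IsConjugateAlong (g : InnerProductSpace.Core ℝ (GroupLieAlgebra I G))
    (γ : ℝ → G) (u : ℝ → GroupLieAlgebra I G) (τ : ℝ) : Prop :=
  IsConjugateAt g (γ 0) (mulInvariantVectorField (u 0) (γ 0)) τ (γ τ)

end

end LeftInvariant

end

/-! Write k = γ(0)⁻¹γ(τ). The momentum g(u(t), Ad_{γ(t)⁻¹} w) is constant along a geodesic for every
w (`momentum_eq`). Comparing times 0 and τ, and using that Ad_{k⁻¹} is orthogonal because right
multiplication by k is an isometry, gives u(τ) = Ad_{k⁻¹} u(0). Hence t ↦ γ(t + τ) and t ↦ γ(t)k are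
geodesics with the same initial data, so γ(s)⁻¹γ(s + τ) = k for all s. After rescaling time and
translating to 1, this says exp_1(τ u(s)) = k for every s (`IsGeodesic.endsAt_of_isometry`). The
exponential map is therefore constant along s ↦ τ u(s), and its differential kills τ u'(0) = τ
ad⋆_{u(0)} u(0). This vector is nonzero: otherwise the constant u(0) would solve the Euler-Arnold
equation, and by uniqueness (`IsEulerOn.eqOn`) u would be constant.

The argument also needs exp to be everywhere defined, single-valued and differentiable. In the chart
at 1 the geodesic equation is an ODE with equilibrium (1, 0), so exp is defined and differentiable
for small velocities (`exists_hasSmoothExp`). Energy is conserved, so a geodesic can be restarted at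
half time; each doubling multiplies the admissible energy by four (`HasSmoothExp.four_mul`,
`hasSmoothExp`). Uniqueness of geodesics identifies the result with `riemExp` (`riemExp_eq`).

All computations are made in the chart at 1, after left translation;
`hasMFDerivWithinAt_iff_hasLeftVel` and `bracket_eq_chartBracket` link them to the intrinsic
notions. -/

noncomputable section

namespace LeftInvariant

/-! ### Differentiable dependence of a flow on its initial condition. -/

section ODE

open scoped NNReal Topology

variable {V : Type*} [NormedAddCommGroup V] [NormedSpace ℝ V]

/-- Taylor's inequality for a map whose derivative is Lipschitz. -/
lemma norm_sub_sub_fderiv_le {W : Type*} [NormedAddCommGroup W] [NormedSpace ℝ W] {f : V → W}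
    {M : ℝ≥0} (hf : Differentiable ℝ f) (hM : LipschitzWith M (fderiv ℝ f)) (x y : V) :
    ‖f y - f x - fderiv ℝ f x (y - x)‖ ≤ M * ‖y - x‖ ^ 2 := by
  have h := Convex.norm_image_sub_le_of_norm_fderiv_le' (𝕜 := ℝ) (f := f) (s := segment ℝ x y)
    (φ := fderiv ℝ f x) (C := M * ‖y - x‖) (x := x) (y := y) (fun z _ => hf z)
    (fun z hz => ?_) (convex_segment x y) (left_mem_segment ℝ x y) (right_mem_segment ℝ x y)
  · linarith
  · rw [← dist_eq_norm]
    refine (hM.dist_le_mul z x).trans ?_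
    gcongr
    rw [dist_eq_norm]
    exact norm_sub_le_of_mem_segment hz

/-- Grönwall and uniqueness theorems are stated with right derivatives, whereas solutions here live
on closed intervals. -/
lemma hasDerivWithinAt_Ici_of_Icc {f : ℝ → V} {v : V} {a b t : ℝ}
    (h : HasDerivWithinAt f v (Icc a b) t) (ht : t ∈ Ico a b) : HasDerivWithinAt f v (Ici t) t :=
  h.mono_of_mem_nhdsWithin
    (Filter.mem_of_superset (Icc_mem_nhdsGE ht.2) (Icc_subset_Icc_left ht.1))

lemma gronwallBound_zero_mul (K ε x : ℝ) :
    gronwallBound 0 K ε x = ε * gronwallBound 0 K 1 x := by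
  unfold gronwallBound
  split_ifs <;> ring

/-- The flow at time one of a bounded vector field of class `C^{1,1}` with small Lipschitz constant
depends differentiably on the initial condition. -/
theorem exists_differentiable_flow [CompleteSpace V] {f : V → V} {K L M : ℝ≥0}
    (hK : K ≤ 1 / 2) (hL : ∀ x, ‖f x‖ ≤ L) (hf : Differentiable ℝ f) (hfK : LipschitzWith K f)
    (hM : LipschitzWith M (fderiv ℝ f)) :
    ∃ α : V → ℝ → V, ∀ z, α z 0 = z ∧
      (∀ t ∈ Icc (0 : ℝ) 1, HasDerivWithinAt (α z) (f (α z t)) (Icc 0 1) t) ∧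
      DifferentiableAt ℝ (fun w => α w 1) z := by
  have h01 : (0 : ℝ) ∈ Icc (0 : ℝ) 1 := ⟨le_rfl, zero_le_one⟩
  have hex : ∀ z, ∃ α : ℝ → V, α 0 = z ∧
      ∀ t ∈ Icc (0 : ℝ) 1, HasDerivWithinAt α (f (α t)) (Icc 0 1) t := fun z =>
    (IsPicardLindelof.of_time_independent (t₀ := ⟨0, h01⟩) (a := L) (r := 0) (L := L)
      (fun x _ => hL x) hfK.lipschitzOnWith
      (by simp)).exists_eq_forall_mem_Icc_hasDerivWithinAt₀
  choose α hα0 hα using hex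
  have hαc : ∀ z, ContinuousOn (α z) (Icc 0 1) := fun z t ht => (hα z t ht).continuousWithinAt
  refine ⟨α, fun z => ⟨hα0 z, hα z, ?_⟩⟩
  have hDK : ∀ x, ‖fderiv ℝ f x‖ ≤ K := fun x => norm_fderiv_le_of_lipschitz ℝ hfK
  have hDK' : ∀ x (A B : V →L[ℝ] V), ‖(fderiv ℝ f x).comp A - (fderiv ℝ f x).comp B‖
      ≤ K * ‖A - B‖ := fun x A B => by
    rw [← ContinuousLinearMap.comp_sub]
    exact (ContinuousLinearMap.opNorm_comp_le _ _).trans (by gcongr; exact hDK x)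
  have hId : ‖ContinuousLinearMap.id ℝ V‖ ≤ 1 := ContinuousLinearMap.norm_id_le
  -- The variational equation A' = Df(α z t) ∘ A, A(0) = id. In the unit ball about id one has ‖A‖ ≤
  -- 2, so the speed is at most 2K, and K ≤ 1/2 keeps the solution in that ball up to time 1.
  have hPL : IsPicardLindelof (fun t (A : V →L[ℝ] V) => (fderiv ℝ f (α z t)).comp A)
      (tmin := 0) (tmax := 1) ⟨0, h01⟩ (ContinuousLinearMap.id ℝ V) 1 0 (2 * K) K :=
    { lipschitzOnWith := fun t _ => LipschitzOnWith.of_dist_le_mul fun A _ B _ => by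
        simpa only [dist_eq_norm] using hDK' (α z t) A B
      continuousOn := fun A _ => ((hM.continuous.comp_continuousOn (hαc z)).clm_comp
        continuousOn_const)
      norm_le := fun t _ A hA => by
        have h1 : ‖A‖ ≤ 2 := by
          have h2 : ‖A - ContinuousLinearMap.id ℝ V‖ ≤ 1 := by
            simpa [dist_eq_norm] using hA
          have := norm_le_norm_sub_add A (ContinuousLinearMap.id ℝ V)
          linarith
        refine (ContinuousLinearMap.opNorm_comp_le _ _).trans ?_
        rw [NNReal.coe_mul, mul_comm]
        exact mul_le_mul h1 (hDK _) (norm_nonneg _) zero_le_two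
      mul_max_le := by
        have h2 : (K : ℝ) ≤ 1 / 2 := by exact_mod_cast hK
        have h3 : max ((1 : ℝ) - 0) (0 - 0) = 1 := by norm_num
        simp only [h3, NNReal.coe_mul, NNReal.coe_one, NNReal.coe_zero, NNReal.coe_ofNat]
        linarith }
  obtain ⟨A, hA0, hA⟩ := hPL.exists_eq_forall_mem_Icc_hasDerivWithinAt₀
  simp only at hA0
  have hAc : ContinuousOn A (Icc 0 1) := fun t ht => (hA t ht).continuousWithinAt
  obtain ⟨C, hC⟩ := isCompact_Icc.exists_bound_of_continuousOn hAc
  have hC0 : 0 ≤ C := (norm_nonneg _).trans (hC 0 h01)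
  set D : ℝ := (M * C ^ 2) * gronwallBound 0 K 1 1 with hD
  -- By Taylor's inequality α z + A h solves the equation for α (z + h) up to an error M C² ‖h‖².
  -- With no initial error, Grönwall's bound is proportional to this, hence quadratic in h.
  have key : ∀ h : V, ‖α (z + h) 1 - α z 1 - A 1 h‖ ≤ D * ‖h‖ ^ 2 := fun h => by
    have hy : ∀ t ∈ Icc (0 : ℝ) 1, HasDerivWithinAt (fun t => α z t + A t h)
        (f (α z t) + fderiv ℝ f (α z t) (A t h)) (Icc 0 1) t := fun t ht =>
      (hα z t ht).add (by simpa using (hA t ht).clm_apply (hasDerivWithinAt_const t _ h))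
    have := dist_le_of_approx_trajectories_ODE (v := fun _ => f) (K := K) (a := 0) (b := 1)
      (f := α (z + h)) (f' := fun t => f (α (z + h) t)) (g := fun t => α z t + A t h)
      (g' := fun t => f (α z t) + fderiv ℝ f (α z t) (A t h)) (εf := 0)
      (εg := M * C ^ 2 * ‖h‖ ^ 2) (δ := 0)
      (fun _ => hfK) (hαc _)
      (fun t ht => hasDerivWithinAt_Ici_of_Icc (hα (z + h) t (Ico_subset_Icc_self ht)) ht)
      (fun t _ => by simp)
      (fun t ht => (hy t ht).continuousWithinAt)
      (fun t ht => hasDerivWithinAt_Ici_of_Icc (hy t (Ico_subset_Icc_self ht)) ht)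
      (fun t ht => ?_) (by simp [hα0, hA0]) 1 ⟨zero_le_one, le_rfl⟩
    · rw [dist_eq_norm, gronwallBound_zero_mul, sub_zero, zero_add] at this
      calc _ = ‖α (z + h) 1 - (α z 1 + A 1 h)‖ := by rw [sub_sub]
        _ ≤ _ := this
        _ = _ := by rw [hD]; ring
    · rw [dist_comm, dist_eq_norm]
      have h1 := norm_sub_sub_fderiv_le hf hM (α z t) (α z t + A t h)
      rw [add_sub_cancel_left, sub_sub] at h1
      refine h1.trans ?_
      have h2 : ‖A t h‖ ≤ C * ‖h‖ :=
        (A t).le_of_opNorm_le (hC t (Ico_subset_Icc_self ht)) h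
      calc (M : ℝ) * ‖A t h‖ ^ 2 ≤ M * (C * ‖h‖) ^ 2 := by gcongr
        _ = _ := by ring
  refine HasFDerivAt.differentiableAt (f' := A 1) ?_
  rw [hasFDerivAt_iff_isLittleO_nhds_zero]
  refine Asymptotics.IsBigO.trans_isLittleO (g := fun h : V => ‖h‖ ^ 2) ?_ ?_
  · refine Asymptotics.IsBigO.of_bound D (Filter.Eventually.of_forall fun h => ?_)
    simpa using key h
  · exact Asymptotics.isLittleO_norm_pow_id one_lt_two

end ODE

/-! ### Multiplication, conjugation and Ad in the chart at the identity. -/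

section ChartAtOne

open scoped Topology
open Filter

variable {E : Type*} [NormedAddCommGroup E] [NormedSpace ℝ E]
  {H : Type*} [TopologicalSpace H] (I : ModelWithCorners ℝ E H)
  {G : Type*} [TopologicalSpace G] [ChartedSpace H G] [Group G]

/-- The preferred chart of a Lie group at the identity. -/
def oneChart (q : G) : E := extChartAt I (1 : G) q

variable (G) in
/-- The inverse of the preferred chart of a Lie group at the identity. -/
def oneParam (x : E) : G := (extChartAt I (1 : G)).symm x

variable (G) in
/-- The coordinate of the identity. -/
def oneCoord : E := oneChart I (1 : G)

@[simp] lemma oneChart_one : oneChart I (1 : G) = oneCoord I G := rfl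

@[simp] lemma oneParam_oneCoord : oneParam I G (oneCoord I G) = 1 :=
  extChartAt_to_inv (I := I) (1 : G)

lemma eventually_oneParam_oneChart : ∀ᶠ q in 𝓝 (1 : G), oneParam I G (oneChart I q) = q := by
  filter_upwards [extChartAt_source_mem_nhds (I := I) (1 : G)] with q hq
  exact (extChartAt I (1 : G)).left_inv hq

lemma continuousAt_oneParam : ContinuousAt (oneParam I G) (oneCoord I G) :=
  continuousAt_extChartAt_symm 1

lemma tendsto_oneParam : Tendsto (oneParam I G) (𝓝 (oneCoord I G)) (𝓝 1) := by
  simpa using (continuousAt_oneParam I (G := G)).tendsto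

lemma contMDiffAt_oneChart [LieGroup I ∞ G] : ∀ᶠ q in 𝓝 (1 : G), ContMDiffAt I 𝓘(ℝ, E) ∞ (oneChart I) q := by
  have : IsManifold I ∞ G := inferInstance
  filter_upwards [chart_source_mem_nhds H (1 : G)] with q hq
  exact contMDiffAt_extChartAt' hq

lemma tendsto_conj_oneParam [LieGroup I ∞ G] (h : G) :
    Tendsto (fun x => h⁻¹ * oneParam I G x * h) (𝓝 (oneCoord I G)) (𝓝 1) := by
  have : IsTopologicalGroup G := topologicalGroup_of_lieGroup I ∞
  have : Tendsto (fun x => h⁻¹ * oneParam I G x * h) (𝓝 (oneCoord I G)) (𝓝 (h⁻¹ * 1 * h)) :=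
    ((tendsto_oneParam I).const_mul h⁻¹).mul_const h
  simpa using this

lemma contDiffAt_oneChart_comp {W : Type*} [NormedAddCommGroup W] [NormedSpace ℝ W] {f : W → G}
    {w : W} (hf : ContMDiffAt 𝓘(ℝ, W) I ∞ f w) (hw : ContMDiffAt I 𝓘(ℝ, E) ∞ (oneChart I) (f w)) :
    ContDiffAt ℝ ∞ (fun x => oneChart I (f x)) w :=
  contMDiffAt_iff_contDiffAt.1 (hw.comp w hf)

/-- Multiplication of the group in the chart at the identity. -/
def chartMul (G : Type*) [TopologicalSpace G] [ChartedSpace H G] [Group G] (p : E × E) : E :=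
  oneChart I (oneParam I G p.1 * oneParam I G p.2)

/-- Conjugation in the chart at the identity. -/
def chartConj (G : Type*) [TopologicalSpace G] [ChartedSpace H G] [Group G] (p : E × E) : E :=
  oneChart I ((oneParam I G p.1)⁻¹ * oneParam I G p.2 * oneParam I G p.1)

lemma eventually_oneParam_chartMul [LieGroup I ∞ G] : ∀ᶠ p : E × E in 𝓝 (oneCoord I G, oneCoord I G),
    oneParam I G (chartMul I G p) = oneParam I G p.1 * oneParam I G p.2 := by
  have : IsTopologicalGroup G := topologicalGroup_of_lieGroup I ∞
  have : Tendsto (fun p : E × E => oneParam I G p.1 * oneParam I G p.2)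
      (𝓝 (oneCoord I G, oneCoord I G)) (𝓝 (1 * 1)) :=
    ((tendsto_oneParam I).comp (continuous_fst.tendsto (oneCoord I G, oneCoord I G))).mul
      ((tendsto_oneParam I).comp (continuous_snd.tendsto (oneCoord I G, oneCoord I G)))
  rw [mul_one] at this
  exact this.eventually (eventually_oneParam_oneChart I)

variable [I.Boundaryless]

lemma eventually_oneChart_oneParam :
    ∀ᶠ x in 𝓝 (oneCoord I G), oneChart I (oneParam I G x) = x := by
  filter_upwards [extChartAt_target_mem_nhds (I := I) (1 : G)] with x hx
  exact (extChartAt I (1 : G)).right_inv hx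

variable [LieGroup I ∞ G]

lemma contMDiffAt_oneParam :
    ∀ᶠ x in 𝓝 (oneCoord I G), ContMDiffAt 𝓘(ℝ, E) I ∞ (oneParam I G) x := by
  have : IsManifold I ∞ G := inferInstance
  filter_upwards [(extChartAt_target_mem_nhds (I := I) (1 : G)),
    eventually_mem_nhds_iff.2 (extChartAt_target_mem_nhds (I := I) (1 : G))] with x hx hx'
  exact (contMDiffOn_extChartAt_symm (1 : G) x hx).contMDiffAt hx'

lemma contMDiffAt_oneParam_comp {W : Type*} [NormedAddCommGroup W] [NormedSpace ℝ W] {f : W → E}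
    {w : W} (hf : ContDiff ℝ ∞ f) (hw : f w = oneCoord I G) :
    ContMDiffAt 𝓘(ℝ, W) I ∞ (fun x => oneParam I G (f x)) w :=
  ContMDiffAt.comp w (g := oneParam I G) (by rw [hw]; exact (contMDiffAt_oneParam I).self_of_nhds)
    hf.contMDiff.contMDiffAt

lemma contDiffAt_chartMul : ContDiffAt ℝ ∞ (chartMul I G) (oneCoord I G, oneCoord I G) := by
  refine contDiffAt_oneChart_comp I
    ((contMDiffAt_oneParam_comp I contDiff_fst rfl).mul
      (contMDiffAt_oneParam_comp I contDiff_snd rfl)) ?_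
  simpa using (contMDiffAt_oneChart I (G := G)).self_of_nhds

lemma contDiffAt_chartConj : ContDiffAt ℝ ∞ (chartConj I G) (oneCoord I G, oneCoord I G) := by
  refine contDiffAt_oneChart_comp I
    (((contMDiffAt_oneParam_comp I contDiff_fst rfl).inv.mul
      (contMDiffAt_oneParam_comp I contDiff_snd rfl)).mul
      (contMDiffAt_oneParam_comp I contDiff_fst rfl)) ?_
  simpa using (contMDiffAt_oneChart I (G := G)).self_of_nhds

lemma eventually_differentiableAt_chartMul :
    ∀ᶠ p in 𝓝 (oneCoord I G, oneCoord I G), DifferentiableAt ℝ (chartMul I G) p :=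
  (((contDiffAt_chartMul I (G := G)).of_le (m := 1) (by simp)).eventually (by simp)).mono
    fun _ hp => hp.differentiableAt (by simp)

/-- The map `x ↦ k x h` read in the chart, for `k h` close to `1`. -/
lemma contDiffAt_translate {k h : G} (hk : ContMDiffAt I 𝓘(ℝ, E) ∞ (oneChart I) (k * h)) :
    ContDiffAt ℝ ∞ (fun x => oneChart I (k * oneParam I G x * h)) (oneCoord I G) := by
  refine contDiffAt_oneChart_comp I
    ((contMDiffAt_const.mul (contMDiffAt_oneParam_comp I contDiff_id rfl)).mul
      contMDiffAt_const) ?_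
  simpa using hk

/-- The operator `Ad_{h⁻¹}`, the differential at `1` of `q ↦ h⁻¹ q h`. -/
def AdInv (h : G) : E →L[ℝ] E :=
  fderiv ℝ (fun x => oneChart I (h⁻¹ * oneParam I G x * h)) (oneCoord I G)

lemma hasFDerivAt_AdInv (h : G) :
    HasFDerivAt (fun x => oneChart I (h⁻¹ * oneParam I G x * h)) (AdInv I h) (oneCoord I G) :=
  ((contDiffAt_translate I (by simpa using (contMDiffAt_oneChart I (G := G)).self_of_nhds)
    ).differentiableAt (by simp)).hasFDerivAt

lemma AdInv_one : AdInv I (1 : G) = ContinuousLinearMap.id ℝ E := by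
  refine (hasFDerivAt_AdInv I (1 : G)).unique ?_
  refine (hasFDerivAt_id _).congr_of_eventuallyEq ?_
  filter_upwards [eventually_oneChart_oneParam I (G := G)] with x hx
  simpa using hx

lemma AdInv_mul (h k : G) : AdInv I (h * k) = (AdInv I k).comp (AdInv I h) := by
  have h1 := (hasFDerivAt_AdInv I k)
  have h2 := HasFDerivAt.comp (g := fun x => oneChart I (k⁻¹ * oneParam I G x * k))
    (g' := AdInv I k) (oneCoord I G) (by simpa using h1) (hasFDerivAt_AdInv I h)
  refine (hasFDerivAt_AdInv I (h * k)).unique (h2.congr_of_eventuallyEq ?_)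
  filter_upwards [(tendsto_conj_oneParam I h).eventually (eventually_oneParam_oneChart I)] with x hx
  simp only [Function.comp, hx]
  group

lemma AdInv_mul_apply (h k : G) (x : E) : AdInv I (h * k) x = AdInv I k (AdInv I h x) := by
  rw [AdInv_mul]; rfl

@[simp] lemma AdInv_apply_inv (h : G) (x : E) : AdInv I h (AdInv I h⁻¹ x) = x := by
  rw [← AdInv_mul_apply, inv_mul_cancel, AdInv_one]; rfl

/-- The second derivative at the identity of the multiplication in the chart. -/
def mulSnd (G : Type*) [TopologicalSpace G] [ChartedSpace H G] [Group G] :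
    (E × E) →L[ℝ] (E × E) →L[ℝ] E :=
  fderiv ℝ (fderiv ℝ (chartMul I G)) (oneCoord I G, oneCoord I G)

lemma hasFDerivAt_mulSnd :
    HasFDerivAt (fderiv ℝ (chartMul I G)) (mulSnd I G) (oneCoord I G, oneCoord I G) :=
  (((contDiffAt_chartMul I (G := G)).fderiv_right (m := 1) (by rw [one_add_one_eq_two]; exact ENat.LEInfty.out)).differentiableAt (by simp)).hasFDerivAt

lemma mulSnd_symm (p q : E × E) : mulSnd I G p q = mulSnd I G q p :=
  (contDiffAt_chartMul I (G := G)).isSymmSndFDerivAt (by simpa using ENat.LEInfty.out) p q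

/-- Since 1 · y = y, the chart multiplication is the identity in its second variable when the first
is the coordinate of 1. -/
lemma fderiv_chartMul_snd (y : E) :
    fderiv ℝ (chartMul I G) (oneCoord I G, oneCoord I G) (0, y) = y := by
  have h1 := ((contDiffAt_chartMul I (G := G)).differentiableAt (by simp)).hasFDerivAt.comp
    (oneCoord I G) (hasFDerivAt_prodMk_right (𝕜 := ℝ) (oneCoord I G) (oneCoord I G))
  have h2 : HasFDerivAt (chartMul I G ∘ fun y => (oneCoord I G, y))
      (ContinuousLinearMap.id ℝ E) (oneCoord I G) := by
    refine (hasFDerivAt_id _).congr_of_eventuallyEq ?_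
    filter_upwards [eventually_oneChart_oneParam I (G := G)] with x hx
    simpa [chartMul] using hx
  simpa using DFunLike.congr_fun (h1.unique h2) y

/-- The derivative at the identity of `q ↦ Ad_{q⁻¹} w` in the direction `v` is `-[v, w]`, the
bracket being expressed through the second derivative of the multiplication. -/
lemma hasFDerivAt_AdInv_oneParam (w : E) :
    ∃ D : E →L[ℝ] E, HasFDerivAt (fun x => AdInv I (oneParam I G x) w) D (oneCoord I G) ∧
      ∀ v, D v = mulSnd I G (w, 0) (0, v) - mulSnd I G (v, 0) (0, w) := by
  have : IsTopologicalGroup G := topologicalGroup_of_lieGroup I ∞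
  set e := oneCoord I G with he
  have hm : ∀ᶠ p in 𝓝 (e, e), DifferentiableAt ℝ (chartMul I G) p :=
    eventually_differentiableAt_chartMul I
  have hc : ∀ᶠ p in 𝓝 (e, e), DifferentiableAt ℝ (chartConj I G) p :=
    (((contDiffAt_chartConj I (G := G)).of_le (m := 1) (by simp)).eventually (by simp)).mono
      fun p hp => hp.differentiableAt (by simp)
  have t1 : Tendsto (fun x : E => (x, e)) (𝓝 e) (𝓝 (e, e)) :=
    (Continuous.prodMk_left e).tendsto e
  have t2 : Tendsto (fun x : E => (e, x)) (𝓝 e) (𝓝 (e, e)) :=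
    (Continuous.prodMk_right e).tendsto e
  have hce : ∀ x, chartConj I G (x, e) = e := fun x => by simp [chartConj, he]
  have hAd : ∀ᶠ x in 𝓝 e, AdInv I (oneParam I G x) w = fderiv ℝ (chartConj I G) (x, e) (0, w) := by
    filter_upwards [t1.eventually hc] with x hx
    have h1 := hx.hasFDerivAt.comp e (hasFDerivAt_prodMk_right (𝕜 := ℝ) x e)
    have h2 := DFunLike.congr_fun (h1.unique (hasFDerivAt_AdInv I (oneParam I G x))) w
    simpa using h2.symm
  -- The identity x (x⁻¹ y x) = y x gives the derivative of Ad by implicit differentiation, without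
  -- differentiating the inversion: once in y at 1 (`hpart`), then in x at 1.
  have hid : ∀ᶠ p : E × E in 𝓝 (e, e), chartMul I G (p.1, chartConj I G p)
      = chartMul I G (p.2, p.1) := by
    have : Tendsto (fun p : E × E => (oneParam I G p.1)⁻¹ * oneParam I G p.2 * oneParam I G p.1)
        (𝓝 (e, e)) (𝓝 (1⁻¹ * 1 * 1)) :=
      (((tendsto_oneParam I).comp (continuous_fst.tendsto (e, e))).inv.mul
        ((tendsto_oneParam I).comp (continuous_snd.tendsto (e, e)))).mul
        ((tendsto_oneParam I).comp (continuous_fst.tendsto (e, e)))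
    rw [inv_one, mul_one, mul_one] at this
    filter_upwards [this.eventually (eventually_oneParam_oneChart I)] with p hp
    simp only [chartMul, chartConj, hp]
    congr 1
    group
  have hpart : ∀ᶠ x in 𝓝 e, fderiv ℝ (chartMul I G) (x, e) (0, AdInv I (oneParam I G x) w)
      = fderiv ℝ (chartMul I G) (e, x) (w, 0) := by
    filter_upwards [t1.eventually hm, t2.eventually hm, t1.eventually hc, hAd,
      t1.eventually hid.eventually_nhds] with x h1 h2 h3 h4 h5
    have a1 : HasFDerivAt (fun z => chartMul I G (x, chartConj I G (x, z))) _ e :=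
      HasFDerivAt.comp (g := chartMul I G) (f := fun z => (x, chartConj I G (x, z))) e
      (by rw [hce]; exact h1.hasFDerivAt)
      ((hasFDerivAt_const x e).prodMk (h3.hasFDerivAt.comp e (hasFDerivAt_prodMk_right x e)))
    have a2 := h2.hasFDerivAt.comp e (hasFDerivAt_prodMk_left (𝕜 := ℝ) e x)
    have a3 : (fun z => chartMul I G (x, chartConj I G (x, z))) =ᶠ[𝓝 e]
        (chartMul I G ∘ fun z => (z, x)) :=
      ((Continuous.prodMk_right x).tendsto e).eventually h5
    have := DFunLike.congr_fun (a1.unique (a2.congr_of_eventuallyEq a3)) w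
    rw [h4]
    simpa using this
  -- Implicit differentiation yields the formula only once the derivative is known to exist;
  -- existence comes from smoothness of the conjugation.
  have hD : DifferentiableAt ℝ (fun x => AdInv I (oneParam I G x) w) e := by
    have h1 : DifferentiableAt ℝ (fderiv ℝ (chartConj I G)) (e, e) :=
      ((contDiffAt_chartConj I (G := G)).fderiv_right (m := 1) (by rw [one_add_one_eq_two]; exact ENat.LEInfty.out)).differentiableAt (by simp)
    have h2 : DifferentiableAt ℝ (fun x => fderiv ℝ (chartConj I G) (x, e) (0, w)) e :=
      (DifferentiableAt.comp (g := fderiv ℝ (chartConj I G)) (f := fun x => (x, e)) e h1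
        (hasFDerivAt_prodMk_left (𝕜 := ℝ) e e).differentiableAt).clm_apply
        (differentiableAt_const _)
    exact h2.congr_of_eventuallyEq hAd
  refine ⟨_, hD.hasFDerivAt, fun v => ?_⟩
  set D := fderiv ℝ (fun x => AdInv I (oneParam I G x) w) e with hDdef
  have b1 : HasFDerivAt (fun x => fderiv ℝ (chartMul I G) (x, e) (0, AdInv I (oneParam I G x) w))
      _ e := (HasFDerivAt.comp (g := fderiv ℝ (chartMul I G)) (f := fun x => (x, e)) e
      (hasFDerivAt_mulSnd I) (hasFDerivAt_prodMk_left e e)).clm_apply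
      ((hasFDerivAt_const (0 : E) e).prodMk hD.hasFDerivAt)
  have b2 : HasFDerivAt (fun x => fderiv ℝ (chartMul I G) (e, x) (w, 0))
      _ e := (HasFDerivAt.comp (g := fderiv ℝ (chartMul I G)) (f := fun x => (e, x)) e
      (hasFDerivAt_mulSnd I) (hasFDerivAt_prodMk_right e e)).clm_apply
      (hasFDerivAt_const (w, (0 : E)) e)
  have b3 := DFunLike.congr_fun (b1.unique (b2.congr_of_eventuallyEq hpart)) v
  have h1 : oneParam I G e = 1 := oneParam_oneCoord I
  simp only [add_apply, ContinuousLinearMap.comp_apply,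
    ContinuousLinearMap.flip_apply, ContinuousLinearMap.prod_apply, Function.comp,
    ContinuousLinearMap.inl_apply, ContinuousLinearMap.inr_apply, zero_apply,
    h1, AdInv_one, ContinuousLinearMap.id_apply, ← hDdef, map_zero, zero_add] at b3
  rw [he, fderiv_chartMul_snd] at b3
  rw [mulSnd_symm I (w, 0), ← b3]
  simp
end ChartAtOne

/-! ### Comparison of the intrinsic velocity, metric and bracket with chart expressions. -/

section Bridges

open scoped Topology
open Filter VectorField

variable {E : Type*} [NormedAddCommGroup E] [NormedSpace ℝ E]
  {H : Type*} [TopologicalSpace H] (I : ModelWithCorners ℝ E H)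
  {G : Type*} [TopologicalSpace G] [ChartedSpace H G] [Group G]

/-- At a time when the curve is at 1, its preferred chart is the chart at 1, so the manifold
derivative unfolds to a derivative in `E`. Other times are reduced to this one by left translation.
-/
lemma hasMFDerivWithinAt_curve_iff {γ : ℝ → G} {s : Set ℝ} {t : ℝ} (ht : γ t = 1)
    (L : ℝ →L[ℝ] TangentSpace I (γ t)) :
    HasMFDerivWithinAt 𝓘(ℝ, ℝ) I γ s t L ↔
      ContinuousWithinAt γ s t ∧ HasFDerivWithinAt (F := E) (fun σ => oneChart I (γ σ)) L s t := by
  have h : writtenInExtChartAt 𝓘(ℝ, ℝ) I t γ = fun σ => oneChart I (γ σ) := by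
    ext σ; simp only [writtenInExtChartAt, ht]; rfl
  refine and_congr Iff.rfl ?_
  rw [h]
  simp only [mfld_simps]
  exact Iff.rfl

/-- The curve `γ` has left-translated velocity `u` at time `t`, within the set `s` of times. -/
def HasLeftVel (γ : ℝ → G) (u : E) (s : Set ℝ) (t : ℝ) : Prop :=
  ContinuousWithinAt γ s t ∧ HasDerivWithinAt (fun σ => oneChart I ((γ t)⁻¹ * γ σ)) u s t

lemma isRightIsometry_one (g : InnerProductSpace.Core ℝ (GroupLieAlgebra I G)) :
    IsRightIsometry g (1 : G) := by
  intro p x y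
  have key : ∀ v : TangentSpace I p, (mfderiv I I (fun q : G => q * 1) p v : E) = v := fun v => by
    have : (fun q : G => q * 1) = id := by ext x; simp
    rw [this, mfderiv_id]; rfl
  unfold metric
  erw [key x, key y]
  rw [mul_one]

lemma mfderiv_one_mul (r : G) (v : TangentSpace I r) :
    (mfderiv I I ((1 : G) * ·) r v : E) = v := by
  have h : (fun x => (1 : G) * x) = id := by ext x; simp
  rw [h, mfderiv_id]
  rfl

lemma mfderiv_eq_of_map_one [I.Boundaryless] {F : G → G} (h1 : F 1 = 1) (hF : MDifferentiableAt I I F 1) :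
    (mfderiv I I F 1 : E →L[ℝ] E) =
      fderiv ℝ (fun x => oneChart I (F (oneParam I G x))) (oneCoord I G) := by
  have h : writtenInExtChartAt I I 1 F = fun x => oneChart I (F (oneParam I G x)) := by
    ext σ; simp [writtenInExtChartAt, h1, oneChart, oneParam]
  refine hF.mfderiv.trans ?_
  rw [h, I.range_eq_univ, fderivWithin_univ]
  rfl

lemma hasMFDerivAt_oneParam [I.Boundaryless] :
    HasMFDerivAt 𝓘(ℝ, E) I (oneParam I G) (oneCoord I G) (ContinuousLinearMap.id ℝ E) := by
  refine ⟨continuousAt_oneParam I, ?_⟩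
  have h : writtenInExtChartAt 𝓘(ℝ, E) I (oneCoord I G) (oneParam I G)
      = fun x => oneChart I (oneParam I G x) := by
    ext σ; simp only [writtenInExtChartAt, oneParam_oneCoord]; rfl
  rw [h]
  refine ((hasFDerivAt_id (𝕜 := ℝ) (oneCoord I G)).congr_of_eventuallyEq ?_).hasFDerivWithinAt
  exact eventually_oneChart_oneParam I

lemma hasMFDerivAt_oneChart [I.Boundaryless] :
    HasMFDerivAt I 𝓘(ℝ, E) (extChartAt I (1 : G)) 1 (ContinuousLinearMap.id ℝ E) := by
  refine ⟨continuousAt_extChartAt 1, ?_⟩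
  refine ((hasFDerivAt_id (𝕜 := ℝ) (oneCoord I G)).congr_of_eventuallyEq ?_).hasFDerivWithinAt
  exact eventually_oneChart_oneParam I

variable [LieGroup I ∞ G]

lemma mdifferentiableAt_mulLeft (p q : G) : MDifferentiableAt I I (p * ·) q :=
  (contMDiff_mul_left (I := I) (n := ∞)).mdifferentiable (by simp) q

lemma mdifferentiableAt_mulRight (p q : G) : MDifferentiableAt I I (· * p) q :=
  (contMDiff_mul_right (I := I) (n := ∞)).mdifferentiable (by simp) q

lemma mfderiv_mulLeft_mulLeft (p q r : G) (v : TangentSpace I r) :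
    (mfderiv I I (p * ·) (q * r) (mfderiv I I (q * ·) r v) : E) = mfderiv I I (p * q * ·) r v := by
  have h : (fun x => p * q * x) = (p * ·) ∘ (q * ·) := by ext x; simp [mul_assoc]
  rw [h]
  exact (mfderiv_comp_apply (x := r) (g := (p * ·)) (f := (q * ·)) (mdifferentiableAt_mulLeft I p _)
    (mdifferentiableAt_mulLeft I q r) v).symm

lemma mfderiv_inv_mulInvariantVectorField (p : G) (v : GroupLieAlgebra I G) :
    (mfderiv I I (p⁻¹ * ·) p (mulInvariantVectorField v p) : E) = v := by
  have h := mfderiv_mulLeft_mulLeft I p⁻¹ p 1 v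
  rw [inv_mul_cancel] at h
  rw [mfderiv_one_mul, mul_one] at h
  exact h

/-- The left-translated velocity in the chart at the identity is the intrinsic one. -/
theorem hasMFDerivWithinAt_iff_hasLeftVel {γ : ℝ → G} {u : GroupLieAlgebra I G} {s : Set ℝ}
    {t : ℝ} :
    HasMFDerivWithinAt 𝓘(ℝ, ℝ) I γ s t
      ((1 : ℝ →L[ℝ] ℝ).smulRight (mulInvariantVectorField u (γ t))) ↔
    HasLeftVel I γ u s t := by
  have : IsTopologicalGroup G := topologicalGroup_of_lieGroup I ∞
  have key : ∀ v : E, HasDerivWithinAt (fun σ => oneChart I ((γ t)⁻¹ * γ σ)) v s t ↔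
      HasFDerivWithinAt (fun σ => oneChart I ((γ t)⁻¹ * γ σ)) ((1 : ℝ →L[ℝ] ℝ).smulRight v) s t :=
    fun v => hasDerivWithinAt_iff_hasFDerivWithinAt
  constructor
  · intro h
    have h1 := (mdifferentiableAt_mulLeft I (γ t)⁻¹ (γ t)).hasMFDerivAt.comp_hasMFDerivWithinAt t h
    have h2 := (hasMFDerivWithinAt_curve_iff I (γ := ((γ t)⁻¹ * ·) ∘ γ) (by simp) _).1 h1
    refine ⟨h.1, (key u).2 ?_⟩
    refine HasFDerivWithinAt.congr_fderiv h2.2 (ContinuousLinearMap.ext fun (c : ℝ) => ?_)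
    change mfderiv I I ((γ t)⁻¹ * ·) (γ t) (c • mulInvariantVectorField u (γ t)) = c • (u : E)
    rw [map_smul]
    exact congrArg (c • ·) (mfderiv_inv_mulInvariantVectorField I (γ t) u)
  · rintro ⟨hc, hd⟩
    have hc' : ContinuousWithinAt (fun σ => (γ t)⁻¹ * γ σ) s t := hc.const_mul _
    have h1 := (hasMFDerivWithinAt_curve_iff I (γ := fun σ => (γ t)⁻¹ * γ σ)
      (by simp) ((1 : ℝ →L[ℝ] ℝ).smulRight (u : E))).2 ⟨hc', (key u).1 hd⟩
    have h2 := (mdifferentiableAt_mulLeft I (γ t) ((γ t)⁻¹ * γ t)).hasMFDerivAt.comp_hasMFDerivWithinAt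
      t h1
    have h3 : ((γ t * ·) ∘ fun σ => (γ t)⁻¹ * γ σ) = γ := by ext σ; simp
    rw [h3] at h2
    refine h2.congr_mfderiv (ContinuousLinearMap.ext fun (c : ℝ) => ?_)
    change mfderiv I I (γ t * ·) ((γ t)⁻¹ * γ t) (c • u) = c • mfderiv I I (γ t * ·) 1 u
    rw [inv_mul_cancel, map_smul]

variable [I.Boundaryless]

/-- If right multiplication by `h` is an isometry, then so is `Ad_{h⁻¹}`. -/
lemma IsRightIsometry.inner_AdInv {g : InnerProductSpace.Core ℝ (GroupLieAlgebra I G)} {h : G}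
    (hh : IsRightIsometry g h) (x y : GroupLieAlgebra I G) :
    g.inner (AdInv I h x : E) (AdInv I h y : E) = g.inner x y := by
  -- Right translation by h followed by the left translation back to 1 hidden in the metric is the
  -- conjugation q ↦ h⁻¹ q h. The isometry condition is needed only at the point 1.
  have key : ∀ v : GroupLieAlgebra I G,
      (mfderiv I I (fun q : G => (1 * h)⁻¹ * q) (1 * h) (mfderiv I I (fun q : G => q * h) 1 v) : E)
        = AdInv I h v := fun v => by
    have h1 := mfderiv_comp_apply (x := (1 : G)) (g := ((1 * h)⁻¹ * ·)) (f := (· * h))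
      (mdifferentiableAt_mulLeft I (1 * h)⁻¹ _) (mdifferentiableAt_mulRight I h 1) v
    refine Eq.trans h1.symm ?_
    have h2 := mfderiv_eq_of_map_one I (F := ((1 * h)⁻¹ * ·) ∘ (· * h)) (by simp)
      ((mdifferentiableAt_mulLeft I (1 * h)⁻¹ _).comp _ (mdifferentiableAt_mulRight I h 1))
    refine (DFunLike.congr_fun h2 v).trans ?_
    simp only [AdInv, Function.comp, one_mul, mul_assoc]
    rfl
  have key1 : ∀ v : GroupLieAlgebra I G, (mfderiv I I (fun q : G => 1⁻¹ * q) 1 v : E) = v :=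
    fun v => by rw [inv_one]; exact mfderiv_one_mul I 1 v
  have h0 := hh 1 x y
  unfold metric at h0
  erw [key x, key y, key1 x, key1 y] at h0
  exact h0

lemma mdifferentiableAt_oneParam :
    ∀ᶠ x in 𝓝 (oneCoord I G), MDifferentiableAt 𝓘(ℝ, E) I (oneParam I G) x :=
  (contMDiffAt_oneParam I).mono fun _ hx => hx.mdifferentiableAt (by simp)

/-- Left-invariant vector fields in the chart at the identity. -/
lemma mulInvariantVectorField_oneParam (v : GroupLieAlgebra I G) :
    ∀ᶠ x in 𝓝 (oneCoord I G), (mulInvariantVectorField v (oneParam I G x) : E) =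
      mfderiv 𝓘(ℝ, E) I (oneParam I G) x
        (fderiv ℝ (chartMul I G) (x, oneCoord I G) (0, (v : E)) : E) := by
  set e := oneCoord I G with he
  have t1 : Tendsto (fun x : E => (x, e)) (𝓝 e) (𝓝 (e, e)) :=
    (Continuous.prodMk_left e).tendsto e
  filter_upwards [t1.eventually (eventually_differentiableAt_chartMul I),
    t1.eventually (eventually_oneParam_chartMul I).eventually_nhds,
    mdifferentiableAt_oneParam I, eventually_oneChart_oneParam I] with x h1 h2 h3 h4
  have hx : chartMul I G (x, e) = x := by simpa [chartMul, he] using h4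
  have a1 : HasMFDerivAt 𝓘(ℝ, E) 𝓘(ℝ, E) (fun y => chartMul I G (x, y)) e
      ((fderiv ℝ (chartMul I G) (x, e)).comp (ContinuousLinearMap.inr ℝ E E)) :=
    (h1.hasFDerivAt.comp e (hasFDerivAt_prodMk_right (𝕜 := ℝ) x e)).hasMFDerivAt
  have a2 : HasMFDerivAt 𝓘(ℝ, E) I (oneParam I G) (chartMul I G (x, e))
      (mfderiv 𝓘(ℝ, E) I (oneParam I G) x) := by rw [hx]; exact h3.hasMFDerivAt
  have a3 := HasMFDerivAt.comp e (f := fun y => chartMul I G (x, y)) a2 a1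
  have a4 : HasMFDerivAt I I (oneParam I G x * ·) (oneParam I G e)
      (mfderiv I I (oneParam I G x * ·) 1) := by
    rw [he, oneParam_oneCoord]; exact (mdifferentiableAt_mulLeft I _ _).hasMFDerivAt
  have a5 := HasMFDerivAt.comp e a4 (hasMFDerivAt_oneParam I)
  -- Both sides express y ↦ x y, once through the chart product and once through left translation;
  -- the claim compares their derivatives at y = 1.
  have a6 : (oneParam I G ∘ fun y => chartMul I G (x, y)) =ᶠ[𝓝 e]
      ((oneParam I G x * ·) ∘ oneParam I G) :=
    ((Continuous.prodMk_right x).tendsto e).eventually h2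
  have a7 := hasMFDerivAt_unique a5 (a3.congr_of_eventuallyEq a6.symm)
  have a8 := DFunLike.congr_fun a7 (v : E)
  exact a8

/-- The bracket of the Lie algebra, computed in the chart at the identity. -/
def chartBracket (G : Type*) [TopologicalSpace G] [ChartedSpace H G] [Group G] (v w : E) : E :=
  mulSnd I G (v, 0) (0, w) - mulSnd I G (w, 0) (0, v)

/-- In the chart the left-invariant field of u is x ↦ D₂m(x, 1) u, with m the multiplication. Its
value at 1 is u and its derivative there is a mixed second derivative of m; the vector field bracket
at 1 is then the antisymmetrisation of that. -/
theorem bracket_eq_chartBracket [FiniteDimensional ℝ E] (v w : GroupLieAlgebra I G) :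
    (⁅v, w⁆ : GroupLieAlgebra I G) = chartBracket I G v w := by
  have : IsManifold I 1 G := IsManifold.of_le (n := ∞) (by simp)
  set e := oneCoord I G with he
  have hpull : ∀ u : GroupLieAlgebra I G,
      mpullbackWithin 𝓘(ℝ, E) I (extChartAt I (1 : G)).symm (mulInvariantVectorField u) (range I)
        =ᶠ[𝓝 e] fun x => fderiv ℝ (chartMul I G) (x, e) (0, (u : E)) := fun u => by
    filter_upwards [mulInvariantVectorField_oneParam I u,
      extChartAt_target_mem_nhds (I := I) (1 : G)] with x h1 h2
    have h3 := isInvertible_mfderivWithin_extChartAt_symm h2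
    have h4 : mfderivWithin 𝓘(ℝ, E) I (extChartAt I (1 : G)).symm (range I) x
        = mfderiv 𝓘(ℝ, E) I (oneParam I G) x := by
      rw [I.range_eq_univ, mfderivWithin_univ]; rfl
    refine h3.inverse_apply_eq.2 (h1.trans ?_)
    exact (DFunLike.congr_fun h4 _).symm
  have hder : ∀ u : E, HasFDerivAt (fun x => fderiv ℝ (chartMul I G) (x, e) (0, u))
      _ e := fun u => (HasFDerivAt.comp (g := fderiv ℝ (chartMul I G)) (f := fun x => (x, e)) e
      (hasFDerivAt_mulSnd I) (hasFDerivAt_prodMk_left e e)).clm_apply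
      (hasFDerivAt_const ((0 : E), u) e)
  have hfin : ∀ a b : E, lieBracket ℝ (fun x => fderiv ℝ (chartMul I G) (x, e) (0, a))
      (fun x => fderiv ℝ (chartMul I G) (x, e) (0, b)) e
      = mulSnd I G (a, 0) (0, b) - mulSnd I G (b, 0) (0, a) := fun a b => by
    rw [lieBracket, (hder a).fderiv, (hder b).fderiv]
    simp [he, fderiv_chartMul_snd]
  have hinv : (mfderiv I 𝓘(ℝ, E) (extChartAt I (1 : G)) 1).inverse
      = ContinuousLinearMap.id ℝ E := by
    rw [(hasMFDerivAt_oneChart I (G := G)).mfderiv]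
    exact ContinuousLinearMap.inverse_id
  have hset : (extChartAt I (1 : G)).symm ⁻¹' univ ∩ range I = univ := by
    rw [I.range_eq_univ]; simp
  rw [GroupLieAlgebra.bracket_def, mlieBracket, mlieBracketWithin_apply, hset]
  refine (DFunLike.congr_fun hinv _).trans ?_
  refine (congrFun (lieBracketWithin_univ (𝕜 := ℝ) (E := E)) e).trans ?_
  refine ((hpull v).lieBracket_vectorField_eq (hpull w)).trans ?_
  exact hfin v w

end Bridges

/-! ### Calculus of left-translated velocities. -/

section Velocity

open scoped Topology
open Filter

variable {E : Type*} [NormedAddCommGroup E] [NormedSpace ℝ E]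
  {H : Type*} [TopologicalSpace H] {I : ModelWithCorners ℝ E H}
  {G : Type*} [TopologicalSpace G] [ChartedSpace H G] [Group G]
  {γ : ℝ → G} {u : E} {s : Set ℝ} {t : ℝ}

lemma HasLeftVel.mono {s' : Set ℝ} (h : HasLeftVel I γ u s t) (hs : s' ⊆ s) :
    HasLeftVel I γ u s' t :=
  ⟨h.1.mono hs, h.2.mono hs⟩

lemma HasLeftVel.mono_of_mem_nhdsWithin {s' : Set ℝ} (h : HasLeftVel I γ u s t)
    (hs : s ∈ 𝓝[s'] t) : HasLeftVel I γ u s' t :=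
  ⟨h.1.mono_of_mem_nhdsWithin hs, h.2.mono_of_mem_nhdsWithin hs⟩

lemma HasLeftVel.congr {γ' : ℝ → G} (h : HasLeftVel I γ u s t) (hs : ∀ x ∈ s, γ' x = γ x)
    (ht : γ' t = γ t) : HasLeftVel I γ' u s t := by
  refine ⟨h.1.congr hs ht, ?_⟩
  exact h.2.congr (fun x hx => by rw [hs x hx, ht]) (by rw [ht])

lemma HasLeftVel.comp_affine {s' : Set ℝ} {a b : ℝ} (h : HasLeftVel I γ u s (a * t + b))
    (hs : MapsTo (fun x => a * x + b) s' s) :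
    HasLeftVel I (fun x => γ (a * x + b)) (a • u) s' t := by
  have hd : HasDerivWithinAt (fun x => a * x + b) a s' t := by
    simpa using (((hasDerivAt_id t).const_mul a).add_const b).hasDerivWithinAt
  exact ⟨ContinuousWithinAt.comp (f := fun x => a * x + b) h.1 hd.continuousWithinAt hs,
    HasDerivWithinAt.scomp t (h := fun x => a * x + b) h.2 hd hs⟩

variable [LieGroup I ∞ G]

lemma HasLeftVel.const_mul (h : HasLeftVel I γ u s t) (p : G) :
    HasLeftVel I (fun x => p * γ x) u s t := by
  have : IsTopologicalGroup G := topologicalGroup_of_lieGroup I ∞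
  refine ⟨h.1.const_mul p, ?_⟩
  simpa [mul_assoc] using h.2

lemma HasLeftVel.eventually (h : HasLeftVel I γ u s t) {p : G → Prop} (hp : ∀ᶠ q in 𝓝 1, p q) :
    ∀ᶠ σ in 𝓝[s] t, p ((γ t)⁻¹ * γ σ) := by
  have : IsTopologicalGroup G := topologicalGroup_of_lieGroup I ∞
  have h1 : Tendsto (fun σ => (γ t)⁻¹ * γ σ) (𝓝[s] t) (𝓝 ((γ t)⁻¹ * γ t)) :=
    h.1.tendsto.const_mul _
  rw [inv_mul_cancel] at h1
  exact h1.eventually hp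

/-- Chain rule for functions of `(γ t)⁻¹ (γ σ)` expressed in the chart at the identity. -/
lemma HasLeftVel.hasDerivWithinAt_comp {W : Type*} [NormedAddCommGroup W] [NormedSpace ℝ W]
    (h : HasLeftVel I γ u s t) {F : G → W} {D : E →L[ℝ] W}
    (hF : HasFDerivAt (fun x => F (oneParam I G x)) D (oneCoord I G)) :
    HasDerivWithinAt (fun σ => F ((γ t)⁻¹ * γ σ)) (D u) s t := by
  have h1 : HasDerivWithinAt ((fun x => F (oneParam I G x)) ∘
      fun σ => oneChart I ((γ t)⁻¹ * γ σ)) (D u) s t :=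
    HasFDerivAt.comp_hasDerivWithinAt (f := fun σ => oneChart I ((γ t)⁻¹ * γ σ)) t
      (by simpa using hF) h.2
  refine h1.congr_of_eventuallyEq ?_ (by simp)
  filter_upwards [h.eventually (eventually_oneParam_oneChart I)] with σ hσ
  simp [hσ]

lemma HasLeftVel.hasDerivWithinAt_comp_mul {W : Type*} [NormedAddCommGroup W] [NormedSpace ℝ W]
    (h : HasLeftVel I γ u s t) {F : G → W} {D : E →L[ℝ] W}
    (hF : HasFDerivAt (fun x => F (γ t * oneParam I G x)) D (oneCoord I G)) :
    HasDerivWithinAt (fun σ => F (γ σ)) (D u) s t := by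
  simpa using h.hasDerivWithinAt_comp (F := fun q => F (γ t * q)) hF

variable [I.Boundaryless]

/-- Because (γ(t)k)⁻¹ γ(σ)k = k⁻¹ (γ(t)⁻¹γ(σ)) k. -/
lemma HasLeftVel.mul_const (h : HasLeftVel I γ u s t) (k : G) :
    HasLeftVel I (fun x => γ x * k) (AdInv I k u) s t := by
  have : IsTopologicalGroup G := topologicalGroup_of_lieGroup I ∞
  refine ⟨h.1.mul_const k, ?_⟩
  simpa [mul_assoc] using h.hasDerivWithinAt_comp
    (F := fun q => oneChart I (k⁻¹ * q * k)) (hasFDerivAt_AdInv I k)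

/-- If two curves have the same left-translated velocity, then `γ₁ γ₂⁻¹` is stationary. -/
lemma HasLeftVel.div {γ₁ γ₂ : ℝ → G} (h₁ : HasLeftVel I γ₁ u s t) (h₂ : HasLeftVel I γ₂ u s t) :
    HasLeftVel I (fun x => γ₁ x * (γ₂ x)⁻¹) 0 s t := by
  have : IsTopologicalGroup G := topologicalGroup_of_lieGroup I ∞
  refine ⟨h₁.1.mul h₂.1.inv, ?_⟩
  set e := oneCoord I G with he
  set k := γ₂ t with hk
  -- With a, b the increments γᵢ(t)⁻¹γᵢ(σ), the increment of γ₁γ₂⁻¹ is k (a b⁻¹) k⁻¹, where k =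
  -- γ₂(t). It is trivial for a = b, so the derivative of `F` vanishes on the diagonal vector (u,
  -- u).
  let F : E × E → E := fun p => oneChart I (k * (oneParam I G p.1 * (oneParam I G p.2)⁻¹) * k⁻¹)
  have hF : DifferentiableAt ℝ F (e, e) := by
    refine (contDiffAt_oneChart_comp I ((contMDiffAt_const.mul
      ((contMDiffAt_oneParam_comp I contDiff_fst rfl).mul
      (contMDiffAt_oneParam_comp I contDiff_snd rfl).inv)).mul
        contMDiffAt_const) ?_).differentiableAt (n := ∞) (by simp)
    simpa [he, hk] using (contMDiffAt_oneChart I (G := G)).self_of_nhds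
  have hdiag : fderiv ℝ F (e, e) (u, u) = 0 := by
    have h1 : HasFDerivAt (F ∘ fun x => (x, x)) _ e :=
      HasFDerivAt.comp e (f := fun x => (x, x)) hF.hasFDerivAt
        ((hasFDerivAt_id e).prodMk (hasFDerivAt_id e))
    have h2 : (F ∘ fun x => (x, x)) = fun _ => e := by
      ext x; simp [F, he]
    rw [h2] at h1
    have := DFunLike.congr_fun (h1.unique (hasFDerivAt_const e e)) u
    simpa using this
  have hcomp := HasFDerivAt.comp_hasDerivWithinAt
    (f := fun σ => (oneChart I ((γ₁ t)⁻¹ * γ₁ σ), oneChart I ((γ₂ t)⁻¹ * γ₂ σ))) t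
    (by simpa using hF.hasFDerivAt) (h₁.2.prodMk h₂.2)
  rw [hdiag] at hcomp
  refine hcomp.congr_of_eventuallyEq ?_ (by simp [F])
  filter_upwards [h₁.eventually (eventually_oneParam_oneChart I),
    h₂.eventually (eventually_oneParam_oneChart I)] with σ h1 h2
  simp only [F, Function.comp, h1, h2, hk]
  congr 1
  group

/-- A stationary curve on an interval is constant. -/
lemma eq_of_hasLeftVel_zero {J : Set ℝ} (hJ : J.OrdConnected)
    (h : ∀ t ∈ J, HasLeftVel I γ (0 : E) J t) {a b : ℝ} (ha : a ∈ J) (hb : b ∈ J) :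
    γ a = γ b := by
  have : IsTopologicalGroup G := topologicalGroup_of_lieGroup I ∞
  -- Near t the curve is read in the chart translated to γ(t). The velocity at σ refers to the base
  -- point γ(σ), and the smooth change of base point preserves its vanishing.
  have hloc : ∀ t ∈ J, ∀ᶠ σ in 𝓝[J] t, γ σ = γ t := fun t ht => by
    have h1 := (h t ht).eventually
      ((contMDiffAt_oneChart I (G := G)).and (eventually_oneParam_oneChart I))
    obtain ⟨ε, hε, hball⟩ := Metric.mem_nhdsWithin_iff.1 h1
    have hconv : Convex ℝ (Metric.ball t ε ∩ J) :=
      (convex_ball t ε).inter hJ.convex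
    have hder : ∀ σ ∈ Metric.ball t ε ∩ J,
        HasDerivWithinAt (fun σ => oneChart I ((γ t)⁻¹ * γ σ)) 0 (Metric.ball t ε ∩ J) σ := by
      intro σ hσ
      have h2 : ContMDiffAt I 𝓘(ℝ, E) ∞ (oneChart I) ((γ t)⁻¹ * γ σ) := (hball hσ).1
      have h3 := (contDiffAt_translate I (k := (γ t)⁻¹ * γ σ) (h := 1)
        (by simpa using h2)).differentiableAt (by simp)
      have h4 := (h σ hσ.2).hasDerivWithinAt_comp_mul
        (F := fun q => oneChart I ((γ t)⁻¹ * q)) (by simpa [mul_assoc] using h3.hasFDerivAt)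
      rw [map_zero] at h4
      exact h4.mono inter_subset_right
    filter_upwards [mem_nhdsWithin_of_mem_nhds (Metric.ball_mem_nhds t hε),
      self_mem_nhdsWithin] with σ h2 h3
    have h4 := hconv.norm_image_sub_le_of_norm_hasDerivWithin_le (C := 0) hder (by simp)
      ⟨Metric.mem_ball_self hε, ht⟩ ⟨h2, h3⟩
    rw [zero_mul, norm_le_zero_iff, sub_eq_zero, inv_mul_cancel] at h4
    have h5 : oneParam I G (oneChart I ((γ t)⁻¹ * γ σ)) = (γ t)⁻¹ * γ σ := (hball ⟨h2, h3⟩).2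
    rw [h4, oneChart_one, oneParam_oneCoord] at h5
    exact (inv_mul_eq_one.1 h5.symm).symm
  have : PreconnectedSpace J := Subtype.preconnectedSpace hJ.isPreconnected
  have hlc : IsLocallyConstant (fun x : J => γ x) :=
    (IsLocallyConstant.iff_eventually_eq _).2 fun x => by
      simpa using! (eventually_nhds_subtype_iff J x (fun y => γ y = γ x)).2 (hloc x x.2)
  exact hlc.apply_eq_of_preconnectedSpace ⟨a, ha⟩ ⟨b, hb⟩

/-- A curve on an interval is determined by its velocity and its value at one time. -/
lemma eqOn_of_hasLeftVel {γ₁ γ₂ : ℝ → G} {v : ℝ → E} {J : Set ℝ} (hJ : J.OrdConnected)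
    (h₁ : ∀ t ∈ J, HasLeftVel I γ₁ (v t) J t) (h₂ : ∀ t ∈ J, HasLeftVel I γ₂ (v t) J t) {a : ℝ}
    (ha : a ∈ J) (h : γ₁ a = γ₂ a) : EqOn γ₁ γ₂ J := fun b hb => by
  have := eq_of_hasLeftVel_zero hJ (fun t ht => (h₁ t ht).div (h₂ t ht)) hb ha
  simpa [h, mul_inv_eq_one] using this

lemma hasFDerivAt_AdInv_oneParam_bracket (w : E) :
    ∃ D : E →L[ℝ] E, HasFDerivAt (fun x => AdInv I (oneParam I G x) w) D (oneCoord I G) ∧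
      ∀ v, D v = -chartBracket I G v w := by
  obtain ⟨D, hD, h⟩ := hasFDerivAt_AdInv_oneParam I (G := G) w
  exact ⟨D, hD, fun v => (h v).trans (neg_sub _ _).symm⟩

/-- Transport of `Ad_{γ⁻¹} w` along a curve. -/
lemma HasLeftVel.hasDerivWithinAt_AdInv (h : HasLeftVel I γ u s t) (w : E) :
    HasDerivWithinAt (fun σ => AdInv I (γ σ) w) (-chartBracket I G u (AdInv I (γ t) w)) s t := by
  obtain ⟨D, hD, hDv⟩ := hasFDerivAt_AdInv_oneParam_bracket (I := I) (G := G) (AdInv I (γ t) w)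
  rw [← hDv u]
  refine h.hasDerivWithinAt_comp_mul (F := fun q => AdInv I q w) ?_
  simpa only [AdInv_mul_apply] using hD

/-- `Ad_{h⁻¹}` is a homomorphism of Lie algebras. -/
lemma AdInv_chartBracket (h : G) (v w : E) :
    AdInv I h (chartBracket I G v w) = chartBracket I G (AdInv I h v) (AdInv I h w) := by
  obtain ⟨D, hD, hDv⟩ := hasFDerivAt_AdInv_oneParam_bracket (I := I) (G := G) w
  obtain ⟨D', hD', hDv'⟩ :=
    hasFDerivAt_AdInv_oneParam_bracket (I := I) (G := G) (AdInv I h w)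
  have h1 : HasFDerivAt (fun x => AdInv I h (AdInv I (oneParam I G x) w)) _ (oneCoord I G) :=
    (AdInv I h).hasFDerivAt.comp (oneCoord I G) hD
  have h2 : HasFDerivAt ((fun x => AdInv I (oneParam I G x) (AdInv I h w)) ∘
      fun x => oneChart I (h⁻¹ * oneParam I G x * h)) _ (oneCoord I G) :=
    HasFDerivAt.comp (oneCoord I G) (by simpa using hD') (hasFDerivAt_AdInv I h)
  -- Differentiating Ad_{h⁻¹} Ad_{x⁻¹} w = Ad_{(h⁻¹xh)⁻¹} Ad_{h⁻¹} w at x = 1 produces a bracket on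
  -- each side.
  have h3 : ((fun x => AdInv I (oneParam I G x) (AdInv I h w)) ∘
      fun x => oneChart I (h⁻¹ * oneParam I G x * h)) =ᶠ[𝓝 (oneCoord I G)]
      fun x => AdInv I h (AdInv I (oneParam I G x) w) := by
    filter_upwards [(tendsto_conj_oneParam I h).eventually (eventually_oneParam_oneChart I)]
      with x hx
    simp only [Function.comp, hx]
    rw [← AdInv_mul_apply, ← AdInv_mul_apply]
    congr 2
    group
  have h4 := DFunLike.congr_fun (h1.unique (h2.congr_of_eventuallyEq h3.symm)) v
  simp only [ContinuousLinearMap.comp_apply, hDv, hDv', map_neg] at h4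
  exact neg_injective h4

end Velocity

/-! ### The Euler-Arnold equation: uniqueness, conservation laws, symmetries. -/

section Geodesics

open scoped Topology NNReal
open Filter

variable {E : Type*} [NormedAddCommGroup E] [NormedSpace ℝ E] [FiniteDimensional ℝ E]
  {H : Type*} [TopologicalSpace H] {I : ModelWithCorners ℝ E H}
  {G : Type*} [TopologicalSpace G] [ChartedSpace H G] [Group G]

/-- The inner product on the Lie algebra as a continuous bilinear map on the model space. -/
def innerCLM (g : InnerProductSpace.Core ℝ (GroupLieAlgebra I G)) : E →L[ℝ] E →L[ℝ] ℝ :=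
  LinearMap.toContinuousBilinearMap (show E →ₗ[ℝ] E →ₗ[ℝ] ℝ from form g)

lemma innerCLM_symm (g : InnerProductSpace.Core ℝ (GroupLieAlgebra I G)) (x y : E) :
    innerCLM g x y = innerCLM g y x :=
  (g.conj_inner_symm x y).symm

lemma eq_zero_of_innerCLM_self (g : InnerProductSpace.Core ℝ (GroupLieAlgebra I G)) {x : E}
    (h : innerCLM g x x = 0) : x = 0 :=
  g.definite x h

lemma innerCLM_self_nonneg (g : InnerProductSpace.Core ℝ (GroupLieAlgebra I G)) (x : E) :
    0 ≤ innerCLM g x x :=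
  g.re_inner_nonneg x

/-- The operator ad⋆ is known only through its pairings, so identities for it are tested against
every vector. -/
lemma innerCLM_ext (g : InnerProductSpace.Core ℝ (GroupLieAlgebra I G)) {x y : E}
    (h : ∀ w, innerCLM g x w = innerCLM g y w) : x = y := by
  refine sub_eq_zero.1 (eq_zero_of_innerCLM_self g ?_)
  rw [(innerCLM g).map_sub, sub_apply, h, sub_self]

lemma hasDerivWithinAt_innerCLM {g : InnerProductSpace.Core ℝ (GroupLieAlgebra I G)} {s : Set ℝ}
    {a b : ℝ → E} {a' b' : E} {t : ℝ} (ha : HasDerivWithinAt a a' s t) (hb : HasDerivWithinAt b b' s t) :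
    HasDerivWithinAt (fun t => innerCLM g (a t) (b t))
      (innerCLM g a' (b t) + innerCLM g (a t) b') s t :=
  ((innerCLM g).hasFDerivAt.comp_hasDerivWithinAt t ha).clm_apply hb

/-- The energy controls the norm. -/
lemma exists_norm_sq_le (g : InnerProductSpace.Core ℝ (GroupLieAlgebra I G)) :
    ∃ C : ℝ, 0 < C ∧ ∀ x : E, ‖x‖ ^ 2 ≤ C * innerCLM g x x := by
  have hcont : Continuous fun x : E => innerCLM g x x := by fun_prop
  -- The sphere is empty only when `E` is zero. Otherwise C is the inverse of the minimum of the
  -- energy on the compact unit sphere, by homogeneity.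
  rcases (Metric.sphere (0 : E) 1).eq_empty_or_nonempty with h | h
  · refine ⟨1, one_pos, fun x => ?_⟩
    have hx : x = 0 := by
      by_contra hx
      have : ‖x‖⁻¹ • x ∈ Metric.sphere (0 : E) 1 := by
        simp [norm_smul, inv_mul_cancel₀ (norm_ne_zero_iff.2 hx)]
      simp [h] at this
    simp [hx]
  · obtain ⟨y, hy, hmin⟩ := (isCompact_sphere (0 : E) 1).exists_isMinOn h hcont.continuousOn
    have hy0 : y ≠ 0 := by rintro rfl; simp at hy
    have hpos : 0 < innerCLM g y y :=
      lt_of_le_of_ne (innerCLM_self_nonneg g y) fun h => hy0 (eq_zero_of_innerCLM_self g h.symm)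
    refine ⟨(innerCLM g y y)⁻¹, inv_pos.2 hpos, fun x => ?_⟩
    rcases eq_or_ne x 0 with rfl | hx
    · simp
    have hx' : 0 < ‖x‖ := norm_pos_iff.2 hx
    have h1 : innerCLM g y y ≤ innerCLM g (‖x‖⁻¹ • x) (‖x‖⁻¹ • x) :=
      hmin (by simp [norm_smul, inv_mul_cancel₀ hx'.ne'])
    simp only [map_smul, smul_apply, smul_eq_mul] at h1
    rw [← mul_assoc, ← mul_inv, ← div_eq_inv_mul, le_div_iff₀ (by positivity)] at h1
    rw [← div_eq_inv_mul, le_div_iff₀ hpos]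
    nlinarith

variable [LieGroup I ∞ G]

/-- The operator `ad⋆` on the model space. -/
def modelAdStar (g : InnerProductSpace.Core ℝ (GroupLieAlgebra I G)) (u v : E) : E := adStar g u v

variable [I.Boundaryless]

lemma innerCLM_modelAdStar (g : InnerProductSpace.Core ℝ (GroupLieAlgebra I G)) (u v w : E) :
    innerCLM g (modelAdStar g u v) w = innerCLM g v (chartBracket I G u w) :=
  (inner_adStar g u v w).trans (congrArg (innerCLM g v) (bracket_eq_chartBracket I u w))

/-- `ad⋆` as a continuous bilinear map. -/
def adStarCLM (g : InnerProductSpace.Core ℝ (GroupLieAlgebra I G)) : E →L[ℝ] E →L[ℝ] E :=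
  LinearMap.toContinuousBilinearMap <| LinearMap.mk₂ ℝ (modelAdStar g)
    (fun u u' v => innerCLM_ext g fun w => by
      rw [map_add, add_apply, innerCLM_modelAdStar, innerCLM_modelAdStar, innerCLM_modelAdStar,
        ← map_add]
      congr 1
      have h : ((u + u', 0) : E × E) = (u, 0) + (u', 0) := by simp
      have h' : ((0, u + u') : E × E) = (0, u) + (0, u') := by simp
      simp only [chartBracket, h, h', map_add, add_apply]
      abel)
    (fun c u v => innerCLM_ext g fun w => by
      rw [map_smul, smul_apply, innerCLM_modelAdStar, innerCLM_modelAdStar, ← map_smul]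
      congr 1
      have h : ((c • u, 0) : E × E) = c • (u, 0) := by simp
      have h' : ((0, c • u) : E × E) = c • (0, u) := by simp
      simp only [chartBracket, h, h', map_smul, smul_apply, smul_sub])
    (fun u v v' => innerCLM_ext g fun w => by
      rw [map_add, add_apply, innerCLM_modelAdStar, innerCLM_modelAdStar, innerCLM_modelAdStar,
        map_add, add_apply])
    (fun c u v => innerCLM_ext g fun w => by
      rw [map_smul, smul_apply, innerCLM_modelAdStar, innerCLM_modelAdStar, map_smul, smul_apply])

lemma innerCLM_adStarCLM (g : InnerProductSpace.Core ℝ (GroupLieAlgebra I G))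
    (u v w : E) : innerCLM g (adStarCLM g u v) w = innerCLM g v (chartBracket I G u w) :=
  innerCLM_modelAdStar g u v w

/-- The Euler-Arnold equation on a set of times. -/
def IsEulerOn (g : InnerProductSpace.Core ℝ (GroupLieAlgebra I G)) (u : ℝ → E) (s : Set ℝ) :
    Prop :=
  ∀ t ∈ s, HasDerivWithinAt u (adStarCLM g (u t) (u t)) s t

theorem isGeodesicOn_iff (g : InnerProductSpace.Core ℝ (GroupLieAlgebra I G)) {γ : ℝ → G}
    {u : ℝ → E} {s : Set ℝ} :
    IsGeodesicOn g γ u s ↔ (∀ t ∈ s, HasLeftVel I γ (u t) s t) ∧ IsEulerOn g u s := by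
  have h : ∀ t, HasMFDerivWithinAt 𝓘(ℝ, ℝ) I γ s t
      ((1 : ℝ →L[ℝ] ℝ).smulRight (mulInvariantVectorField (u t) (γ t))) ↔
      HasLeftVel I γ (u t) s t := fun t => hasMFDerivWithinAt_iff_hasLeftVel I
  exact ⟨fun H => ⟨fun t ht => (h t).1 (H t ht).1, fun t ht => (H t ht).2⟩,
    fun H t ht => ⟨(h t).2 (H.1 t ht), H.2 t ht⟩⟩

variable {g : InnerProductSpace.Core ℝ (GroupLieAlgebra I G)} {u u₁ u₂ : ℝ → E} {s : Set ℝ}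

lemma IsEulerOn.mono {s' : Set ℝ} (h : IsEulerOn g u s) (hs : s' ⊆ s) : IsEulerOn g u s' :=
  fun t ht => (h t (hs ht)).mono hs

lemma IsEulerOn.continuousOn (h : IsEulerOn g u s) : ContinuousOn u s :=
  fun t ht => (h t ht).continuousWithinAt

/-- A quadratic field is Lipschitz only on bounded sets: B(x,x) − B(y,y) = B(x, x−y) + B(x−y, y). -/
lemma lipschitzOnWith_adStar (g : InnerProductSpace.Core ℝ (GroupLieAlgebra I G)) (R : ℝ≥0) :
    LipschitzOnWith (2 * ‖adStarCLM g‖₊ * R) (fun x => adStarCLM g x x)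
      (Metric.closedBall 0 R) := by
  refine LipschitzOnWith.of_dist_le_mul fun x hx y hy => ?_
  rw [mem_closedBall_zero_iff] at hx hy
  have h : adStarCLM g x x - adStarCLM g y y = adStarCLM g x (x - y) + adStarCLM g (x - y) y := by
    simp
  rw [dist_eq_norm, dist_eq_norm, h]
  refine (norm_add_le _ _).trans ?_
  have h1 := (adStarCLM g).le_opNorm₂ x (x - y)
  have h2 := (adStarCLM g).le_opNorm₂ (x - y) y
  have h3 : ‖adStarCLM g‖ * ‖x‖ * ‖x - y‖ ≤ ‖adStarCLM g‖ * R * ‖x - y‖ := by gcongr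
  have h4 : ‖adStarCLM g‖ * ‖x - y‖ * ‖y‖ ≤ ‖adStarCLM g‖ * ‖x - y‖ * R := by gcongr
  simp only [NNReal.coe_mul, NNReal.coe_ofNat, coe_nnnorm]
  linarith

/-- Solutions of the Euler-Arnold equation on an interval are determined by one value. -/
theorem IsEulerOn.eqOn {J : Set ℝ} (hJ : J.OrdConnected) (h₁ : IsEulerOn g u₁ J)
    (h₂ : IsEulerOn g u₂ J) {a : ℝ} (ha : a ∈ J) (h : u₁ a = u₂ a) : EqOn u₁ u₂ J := by
  intro b hb
  -- On a compact subinterval both solutions stay in one ball, where the field is Lipschitz.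
  have key : ∀ c d : ℝ, Icc c d ⊆ J → ∃ R : ℝ≥0, ∀ t ∈ Icc c d,
      u₁ t ∈ Metric.closedBall (0 : E) R ∧ u₂ t ∈ Metric.closedBall (0 : E) R := fun c d hcd => by
    obtain ⟨R₁, hR₁⟩ := isCompact_Icc.exists_bound_of_continuousOn (h₁.mono hcd).continuousOn
    obtain ⟨R₂, hR₂⟩ := isCompact_Icc.exists_bound_of_continuousOn (h₂.mono hcd).continuousOn
    refine ⟨(max R₁ R₂).toNNReal, fun t ht => ?_⟩
    simp only [mem_closedBall_zero_iff, Real.coe_toNNReal', le_max_iff]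
    exact ⟨Or.inl (Or.inl (hR₁ t ht)), Or.inl (Or.inr (hR₂ t ht))⟩
  rcases le_total a b with hab | hab
  · have hs : Icc a b ⊆ J := hJ.out ha hb
    obtain ⟨R, hR⟩ := key a b hs
    exact ODE_solution_unique_of_mem_Icc_right (v := fun _ x => adStarCLM g x x)
      (s := fun _ => Metric.closedBall 0 R) (fun _ _ => lipschitzOnWith_adStar g R)
      (h₁.mono hs).continuousOn
      (fun t ht => hasDerivWithinAt_Ici_of_Icc ((h₁.mono hs) t (Ico_subset_Icc_self ht)) ht)
      (fun t ht => (hR t (Ico_subset_Icc_self ht)).1) (h₂.mono hs).continuousOn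
      (fun t ht => hasDerivWithinAt_Ici_of_Icc ((h₂.mono hs) t (Ico_subset_Icc_self ht)) ht)
      (fun t ht => (hR t (Ico_subset_Icc_self ht)).2) h ⟨hab, le_rfl⟩
  · have hs : Icc b a ⊆ J := hJ.out hb ha
    obtain ⟨R, hR⟩ := key b a hs
    have hIic : ∀ {f : ℝ → E} {v : E} {t : ℝ}, t ∈ Ioc b a → HasDerivWithinAt f v (Icc b a) t →
        HasDerivWithinAt f v (Iic t) t := fun ht hf => hf.mono_of_mem_nhdsWithin
      (Filter.mem_of_superset (Icc_mem_nhdsLE ht.1) (Icc_subset_Icc_right ht.2))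
    exact ODE_solution_unique_of_mem_Icc_left (v := fun _ x => adStarCLM g x x)
      (s := fun _ => Metric.closedBall 0 R) (fun _ _ => lipschitzOnWith_adStar g R)
      (h₁.mono hs).continuousOn
      (fun t ht => hIic ht ((h₁.mono hs) t (Ioc_subset_Icc_self ht)))
      (fun t ht => (hR t (Ioc_subset_Icc_self ht)).1) (h₂.mono hs).continuousOn
      (fun t ht => hIic ht ((h₂.mono hs) t (Ioc_subset_Icc_self ht)))
      (fun t ht => (hR t (Ioc_subset_Icc_self ht)).2) h ⟨le_rfl, hab⟩

lemma eq_of_hasDerivWithinAt_zero {f : ℝ → ℝ} {J : Set ℝ} (hJ : J.OrdConnected)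
    (h : ∀ t ∈ J, HasDerivWithinAt f 0 J t) {a b : ℝ} (ha : a ∈ J) (hb : b ∈ J) : f a = f b := by
  have := hJ.convex.norm_image_sub_le_of_norm_hasDerivWithin_le (C := 0) h (by simp) ha hb
  rw [zero_mul, norm_le_zero_iff, sub_eq_zero] at this
  exact this.symm

/-- Conservation of energy. -/
lemma IsEulerOn.energy_eq {J : Set ℝ} (hJ : J.OrdConnected) (h : IsEulerOn g u J) {a b : ℝ}
    (ha : a ∈ J) (hb : b ∈ J) : innerCLM g (u a) (u a) = innerCLM g (u b) (u b) := by
  refine eq_of_hasDerivWithinAt_zero (f := fun t => innerCLM g (u t) (u t)) hJ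
    (fun t ht => ?_) ha hb
  convert! hasDerivWithinAt_innerCLM (g := g) (h t ht) (h t ht) using 1
  -- Each half of the derivative is g(u, [u, u]) = 0.
  rw [innerCLM_symm g (u t), innerCLM_adStarCLM]
  simp [chartBracket]

/-- Conservation of momentum. -/
lemma momentum_eq {J : Set ℝ} (hJ : J.OrdConnected) {γ : ℝ → G}
    (hγ : ∀ t ∈ J, HasLeftVel I γ (u t) J t) (h : IsEulerOn g u J) (w : E) {a b : ℝ}
    (ha : a ∈ J) (hb : b ∈ J) :
    innerCLM g (u a) (AdInv I (γ a) w) = innerCLM g (u b) (AdInv I (γ b) w) := by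
  refine eq_of_hasDerivWithinAt_zero (f := fun t => innerCLM g (u t) (AdInv I (γ t) w)) hJ
    (fun t ht => ?_) ha hb
  convert! hasDerivWithinAt_innerCLM (g := g) (h t ht) ((hγ t ht).hasDerivWithinAt_AdInv w) using 1
  -- With W = Ad_{γ⁻¹} w the derivative is g(ad⋆_u u, W) − g(u, [u, W]), zero by definition of ad⋆.
  rw [innerCLM_adStarCLM, map_neg, add_neg_cancel]

lemma IsEulerOn.comp_affine {s' : Set ℝ} (h : IsEulerOn g u s) (a b : ℝ)
    (hs : MapsTo (fun x => a * x + b) s' s) : IsEulerOn g (fun x => a • u (a * x + b)) s' := by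
  intro t ht
  have hd : HasDerivWithinAt (fun x => a * x + b) a s' t := by
    simpa using (((hasDerivAt_id t).const_mul a).add_const b).hasDerivWithinAt
  simpa using (HasDerivWithinAt.scomp t (h := fun x => a * x + b) (h _ (hs ht)) hd hs).fun_const_smul a

/-- An isometric `Ad_{h⁻¹}` preserves the Euler-Arnold equation. -/
lemma IsEulerOn.adInv {k : G} (h : IsEulerOn g u s)
    (hk : ∀ x y, innerCLM g (AdInv I k x) (AdInv I k y) = innerCLM g x y) :
    IsEulerOn g (fun t => AdInv I k (u t)) s := by
  intro t ht
  convert! (AdInv I k).hasFDerivAt.comp_hasDerivWithinAt t (h t ht) using 1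
  refine innerCLM_ext g fun w => ?_
  -- An orthogonal Lie algebra automorphism commutes with ad⋆; the test vector w is first written as
  -- an image under it.
  rw [← AdInv_apply_inv I k w, innerCLM_adStarCLM, ← AdInv_chartBracket, hk, hk,
    innerCLM_adStarCLM]

/-- A geodesic with its left-translated velocity, in terms of the chart at the identity. -/
structure IsGeodesic (g : InnerProductSpace.Core ℝ (GroupLieAlgebra I G)) (γ : ℝ → G) (u : ℝ → E)
    (s : Set ℝ) : Prop where
  hasLeftVel : ∀ t ∈ s, HasLeftVel I γ (u t) s t
  isEulerOn : IsEulerOn g u s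

variable {γ γ₁ γ₂ : ℝ → G}

lemma IsGeodesic.mono {s' : Set ℝ} (h : IsGeodesic g γ u s) (hs : s' ⊆ s) :
    IsGeodesic g γ u s' :=
  ⟨fun t ht => (h.1 t (hs ht)).mono hs, h.2.mono hs⟩

lemma IsGeodesic.const_mul (h : IsGeodesic g γ u s) (p : G) :
    IsGeodesic g (fun t => p * γ t) u s :=
  ⟨fun t ht => (h.1 t ht).const_mul p, h.2⟩

lemma IsGeodesic.mul_const {k : G} (h : IsGeodesic g γ u s)
    (hk : ∀ x y, innerCLM g (AdInv I k x) (AdInv I k y) = innerCLM g x y) :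
    IsGeodesic g (fun t => γ t * k) (fun t => AdInv I k (u t)) s :=
  ⟨fun t ht => (h.1 t ht).mul_const k, h.2.adInv hk⟩

lemma IsGeodesic.comp_affine {s' : Set ℝ} (h : IsGeodesic g γ u s) (a b : ℝ)
    (hs : MapsTo (fun x => a * x + b) s' s) :
    IsGeodesic g (fun x => γ (a * x + b)) (fun x => a • u (a * x + b)) s' :=
  ⟨fun _ ht => (h.1 _ (hs ht)).comp_affine hs, h.2.comp_affine a b hs⟩

/-- A geodesic on an interval is determined by its initial point and velocity. -/
theorem IsGeodesic.eqOn {J : Set ℝ} (hJ : J.OrdConnected) (h₁ : IsGeodesic g γ₁ u₁ J)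
    (h₂ : IsGeodesic g γ₂ u₂ J) {a : ℝ} (ha : a ∈ J) (hγ : γ₁ a = γ₂ a) (hu : u₁ a = u₂ a) :
    EqOn γ₁ γ₂ J ∧ EqOn u₁ u₂ J := by
  have h := h₁.2.eqOn hJ h₂.2 ha hu
  exact ⟨eqOn_of_hasLeftVel hJ h₁.1 (fun t ht => by rw [h ht]; exact h₂.1 t ht) ha hγ, h⟩

/-- Concatenation of geodesics. -/
lemma IsGeodesic.glue {a b c : ℝ} (hab : a ≤ b) (hbc : b ≤ c) (h₁ : IsGeodesic g γ₁ u₁ (Icc a b))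
    (h₂ : IsGeodesic g γ₂ u₂ (Icc b c)) (hγ : γ₁ b = γ₂ b) (hu : u₁ b = u₂ b) :
    IsGeodesic g (fun t => if t ≤ b then γ₁ t else γ₂ t) (fun t => if t ≤ b then u₁ t else u₂ t)
      (Icc a c) := by
  set γ := fun t => if t ≤ b then γ₁ t else γ₂ t with hγdef
  set u := fun t => if t ≤ b then u₁ t else u₂ t with hudef
  have e₁ : ∀ t ∈ Icc a b, γ t = γ₁ t ∧ u t = u₁ t := fun t ht => by simp [hγdef, hudef, ht.2]
  have e₂ : ∀ t ∈ Icc b c, γ t = γ₂ t ∧ u t = u₂ t := fun t ht => by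
    rcases ht.1.eq_or_lt with rfl | h
    · simp [hγdef, hudef, hγ, hu]
    · simp [hγdef, hudef, not_le.2 h]
  have d₁ : ∀ t ∈ Icc a b, HasLeftVel I γ (u t) (Icc a b) t ∧
      HasDerivWithinAt u (adStarCLM g (u t) (u t)) (Icc a b) t := fun t ht => by
    rw [(e₁ t ht).2]
    exact ⟨(h₁.1 t ht).congr (fun x hx => (e₁ x hx).1) (e₁ t ht).1,
      (h₁.2 t ht).congr (fun x hx => (e₁ x hx).2) (e₁ t ht).2⟩
  have d₂ : ∀ t ∈ Icc b c, HasLeftVel I γ (u t) (Icc b c) t ∧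
      HasDerivWithinAt u (adStarCLM g (u t) (u t)) (Icc b c) t := fun t ht => by
    rw [(e₂ t ht).2]
    exact ⟨(h₂.1 t ht).congr (fun x hx => (e₂ x hx).1) (e₂ t ht).1,
      (h₂.2 t ht).congr (fun x hx => (e₂ x hx).2) (e₂ t ht).2⟩
  have key : ∀ t ∈ Icc a c, HasLeftVel I γ (u t) (Icc a c) t ∧
      HasDerivWithinAt u (adStarCLM g (u t) (u t)) (Icc a c) t := fun t ht => by
    rcases lt_trichotomy t b with h | rfl | h
    · have hm : Icc a b ∈ 𝓝[Icc a c] t := by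
        filter_upwards [self_mem_nhdsWithin, mem_nhdsWithin_of_mem_nhds (Iio_mem_nhds h)]
          with x hx hx' using ⟨hx.1, le_of_lt hx'⟩
      have := d₁ t ⟨ht.1, h.le⟩
      exact ⟨this.1.mono_of_mem_nhdsWithin hm, this.2.mono_of_mem_nhdsWithin hm⟩
    -- Only at the junction are both pieces needed: the derivatives within the two intervals agree
    -- and combine to one within their union.
    · have x₁ := d₁ t ⟨hab, le_rfl⟩
      have x₂ := d₂ t ⟨le_rfl, hbc⟩
      rw [← Icc_union_Icc_eq_Icc hab hbc]
      exact ⟨⟨x₁.1.1.union x₂.1.1, x₁.1.2.union x₂.1.2⟩, x₁.2.union x₂.2⟩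
    · have hm : Icc b c ∈ 𝓝[Icc a c] t := by
        filter_upwards [self_mem_nhdsWithin, mem_nhdsWithin_of_mem_nhds (Ioi_mem_nhds h)]
          with x hx hx' using ⟨le_of_lt hx', hx.2⟩
      have := d₂ t ⟨h.le, ht.2⟩
      exact ⟨this.1.mono_of_mem_nhdsWithin hm, this.2.mono_of_mem_nhdsWithin hm⟩
  exact ⟨fun t ht => (key t ht).1, fun t ht => (key t ht).2⟩

end Geodesics

/-! ### The exponential map for small velocities. -/

section LocalExponential

open scoped Topology NNReal
open Filter

variable {E : Type*} [NormedAddCommGroup E] [NormedSpace ℝ E]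
  {H : Type*} [TopologicalSpace H] {I : ModelWithCorners ℝ E H} [I.Boundaryless]
  {G : Type*} [TopologicalSpace G] [ChartedSpace H G] [Group G] [LieGroup I ∞ G]

variable (I G) in
/-- Near the identity, solutions of the flow equation in the chart are curves with the prescribed
left-translated velocity. -/
lemma eventually_hasLeftVel : ∀ᶠ x₀ in 𝓝 (oneCoord I G), ∀ (x : ℝ → E) (u : E) (s : Set ℝ) (t : ℝ),
    x t = x₀ → HasDerivWithinAt x (fderiv ℝ (chartMul I G) (x₀, oneCoord I G) (0, u)) s t →
    HasLeftVel I (fun t => oneParam I G (x t)) u s t := by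
  set e := oneCoord I G with he
  have t1 : Tendsto (fun x : E => (x, e)) (𝓝 e) (𝓝 (e, e)) :=
    (Continuous.prodMk_left e).tendsto e
  filter_upwards [contMDiffAt_oneParam I (G := G),
    t1.eventually (eventually_differentiableAt_chartMul I),
    t1.eventually (eventually_oneParam_chartMul I).eventually_nhds,
    eventually_oneChart_oneParam I (G := G)] with x₀ h1 h2 h3 h4
  rintro x u s t rfl hx
  have hxe : chartMul I G (x t, e) = x t := by simpa [chartMul, he] using h4
  refine ⟨h1.continuousAt.comp_continuousWithinAt hx.continuousWithinAt, ?_⟩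
  set d : E → E := fun y => oneChart I ((oneParam I G (x t))⁻¹ * oneParam I G y) with hd
  have hdiff : DifferentiableAt ℝ d (x t) := by
    refine (contDiffAt_oneChart_comp I (contMDiffAt_const.mul h1) ?_).differentiableAt
      (n := ∞) (by simp)
    simpa using (contMDiffAt_oneChart I (G := G)).self_of_nhds
  have a1 : HasFDerivAt (d ∘ fun y => chartMul I G (x t, y)) _ e :=
    HasFDerivAt.comp e (by rw [hxe]; exact hdiff.hasFDerivAt)
      (h2.hasFDerivAt.comp e (hasFDerivAt_prodMk_right (𝕜 := ℝ) (x t) e))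
  -- Left translation back undoes the product, so the derivative of `d` is a left inverse of the
  -- partial derivative of the multiplication that drives the flow.
  have a2 : (d ∘ fun y => chartMul I G (x t, y)) =ᶠ[𝓝 e] id := by
    filter_upwards [((Continuous.prodMk_right (x t)).tendsto e).eventually h3,
      eventually_oneChart_oneParam I (G := G)] with y h5 h6
    simp only [d, Function.comp, h5, inv_mul_cancel_left, h6, id]
  have a3 := DFunLike.congr_fun (a1.unique ((hasFDerivAt_id e).congr_of_eventuallyEq a2)) u
  have a4 := hdiff.hasFDerivAt.comp_hasDerivWithinAt t hx
  simp only [ContinuousLinearMap.comp_apply, ContinuousLinearMap.inr_apply,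
    ContinuousLinearMap.id_apply] at a3
  rwa [a3] at a4

/-- A vector field of class `C^2` near a zero `z₀` has, after multiplication by a small constant, a
flow defined for times in `[0, 1]` near `z₀`, which is differentiable in the initial condition. -/
theorem exists_differentiable_flow_of_zero {V : Type*} [NormedAddCommGroup V] [NormedSpace ℝ V]
    [FiniteDimensional ℝ V] {f : V → V} {z₀ : V} (hf : ContDiffAt ℝ 2 f z₀) (hf0 : f z₀ = 0)
    {U : Set V} (hU : U ∈ 𝓝 z₀) :
    ∃ ε > (0 : ℝ), ∃ δ > (0 : ℝ), ∃ α : V → ℝ → V, ∀ z ∈ Metric.ball z₀ δ,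
      α z 0 = z ∧ (∀ t ∈ Icc (0 : ℝ) 1, α z t ∈ U ∧
        HasDerivWithinAt (α z) (ε • f (α z t)) (Icc 0 1) t) ∧
      DifferentiableAt ℝ (fun w => α w 1) z := by
  have : CompleteSpace V := FiniteDimensional.complete ℝ V
  obtain ⟨R, hR, hball⟩ := Metric.nhds_basis_closedBall.mem_iff.1
    (Filter.inter_mem (hf.eventually (by simp)) hU)
  -- The cutoff makes the field globally bounded and C^{1,1} without changing it on the ball of
  -- radius R/2.
  let χ : ContDiffBump z₀ := ⟨R / 2, R, by positivity, by linarith⟩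
  set F : V → V := fun z => χ z • f z with hF
  have hsupp : tsupport F ⊆ Metric.closedBall z₀ R := by
    refine (closure_mono (Function.support_smul_subset_left _ _)).trans ?_
    exact χ.tsupport_eq.subset
  have hFc : ContDiff ℝ 2 F := contMDiff_iff_contDiff.1 <| contMDiff_of_tsupport fun z hz =>
    contMDiffAt_iff_contDiffAt.2 <| χ.contDiff.contDiffAt.smul (hball (hsupp hz)).1
  have hFs : HasCompactSupport F := χ.hasCompactSupport.smul_right
  obtain ⟨K, hK⟩ := hFc.lipschitzWith_of_hasCompactSupport hFs (by simp)
  obtain ⟨L, hL⟩ := hFc.continuous.bounded_above_of_compact_support hFs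
  obtain ⟨M, hM⟩ := (hFc.fderiv_right (m := 1) (by rw [one_add_one_eq_two]))
    |>.lipschitzWith_of_hasCompactSupport (hFs.fderiv ℝ) (by simp)
  -- Chosen so that εK ≤ 1/2; the added 1 covers K = 0.
  set ε : ℝ≥0 := (2 * (K + 1))⁻¹ with hε
  have hε0 : 0 < ε := by positivity
  have hεK : ε * K ≤ 1 / 2 := by
    rw [hε, ← div_eq_inv_mul, div_le_div_iff₀ (by positivity) (by positivity)]
    rw [← NNReal.coe_le_coe]; push_cast; linarith [K.coe_nonneg]
  have hlip : LipschitzWith (ε * K) (fun z => (ε : ℝ) • F z) := by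
    refine LipschitzWith.of_dist_le_mul fun x y => ?_
    rw [dist_smul₀, NNReal.coe_mul, mul_assoc]
    refine mul_le_mul (by simp) (hK.dist_le_mul x y) dist_nonneg ε.coe_nonneg
  have hdF : Differentiable ℝ F := hFc.differentiable (by simp)
  obtain ⟨α, hα⟩ := exists_differentiable_flow (f := fun z => (ε : ℝ) • F z) (K := ε * K)
    (L := (ε * L.toNNReal)) (M := ε * M) hεK
    (fun x => by
      rw [norm_smul, NNReal.coe_mul]
      refine mul_le_mul (by simp) ((hL x).trans (Real.le_coe_toNNReal L)) (norm_nonneg _)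
        ε.coe_nonneg)
    (hdF.const_smul _) hlip
    (LipschitzWith.of_dist_le_mul fun x y => by
      rw [fderiv_fun_const_smul (hdF x), fderiv_fun_const_smul (hdF y), dist_smul₀, NNReal.coe_mul,
        mul_assoc]
      exact mul_le_mul (by simp) (hM.dist_le_mul x y) dist_nonneg ε.coe_nonneg)
  have hF0 : F z₀ = 0 := by simp [hF, hf0]
  refine ⟨ε, hε0, R / 2 / Real.exp 1, by positivity, α, fun z hz => ?_⟩
  obtain ⟨h0, h1, h2⟩ := hα z
  refine ⟨h0, fun t ht => ?_, h2⟩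
  -- Comparison with the constant trajectory at z₀: distances grow by at most e^{εKt} ≤ e, so
  -- starting within (R/2)/e keeps the flow where the cutoff is 1.
  have hdist := dist_le_of_trajectories_ODE (v := fun _ z => (ε : ℝ) • F z) (K := ε * K) (a := 0)
    (b := 1) (f := α z) (g := fun _ => z₀) (δ := dist z z₀) (fun _ => hlip)
    (fun t ht => (h1 t ht).continuousWithinAt)
    (fun t ht => hasDerivWithinAt_Ici_of_Icc (h1 t (Ico_subset_Icc_self ht)) ht)
    continuousOn_const (fun t _ => by simpa [hF0] using hasDerivWithinAt_const t (Ici t) z₀)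
    (by rw [h0]) t ht
  have hin : α z t ∈ Metric.closedBall z₀ (R / 2) := by
    rw [Metric.mem_closedBall]
    refine hdist.trans ?_
    have h3 : dist z z₀ ≤ R / 2 / Real.exp 1 := (Metric.mem_ball.1 hz).le
    have h4 : ((ε * K : ℝ≥0) : ℝ) * (t - 0) ≤ 1 := by
      have : ((ε * K : ℝ≥0) : ℝ) ≤ 1 / 2 := by exact_mod_cast hεK
      have h5 := (ε * K).coe_nonneg
      nlinarith [ht.1, ht.2]
    calc _ ≤ R / 2 / Real.exp 1 * Real.exp 1 := by gcongr
      _ = R / 2 := div_mul_cancel₀ _ (Real.exp_pos 1).ne'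
  refine ⟨(hball (Metric.closedBall_subset_closedBall (by linarith) hin)).2, ?_⟩
  have h5 := h1 t ht
  have h6 : F (α z t) = f (α z t) := by
    simp only [hF, χ.one_of_mem_closedBall hin, one_smul]
  rwa [h6] at h5

variable [FiniteDimensional ℝ E] {g : InnerProductSpace.Core ℝ (GroupLieAlgebra I G)}

/-- The geodesic from `1` with initial velocity `v` exists up to time one, where it is at the point
`q` with left-translated velocity `w`. -/
def EndsAt (g : InnerProductSpace.Core ℝ (GroupLieAlgebra I G)) (v : E) (q : G) (w : E) : Prop :=
  ∃ (γ : ℝ → G) (u : ℝ → E), IsGeodesic g γ u (Icc 0 1) ∧ γ 0 = 1 ∧ u 0 = v ∧ γ 1 = q ∧ u 1 = w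

/-- Geodesics from `1` of energy less than `R` exist up to time one and their end points depend
differentiably on the initial velocity. -/
def HasSmoothExp (g : InnerProductSpace.Core ℝ (GroupLieAlgebra I G)) (R : ℝ) : Prop :=
  ∃ (Γ : E → G) (U : E → E), ∀ v, innerCLM g v v < R → EndsAt g v (Γ v) (U v) ∧
    MDifferentiableAt 𝓘(ℝ, E) I Γ v ∧ DifferentiableAt ℝ U v

/-- The geodesic equation is a smooth ODE for (position, velocity) vanishing at (1, 0). Its field is
linear in the velocity in the first component and quadratic in the second, so the slowed flow of ε f
started at velocity v/ε becomes the true geodesic of v once its velocity component is multiplied by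
ε. -/
lemma exists_hasSmoothExp (g : InnerProductSpace.Core ℝ (GroupLieAlgebra I G)) :
    ∃ R > 0, HasSmoothExp g R := by
  set e := oneCoord I G with he
  let f : E × E → E × E := fun z => (fderiv ℝ (chartMul I G) (z.1, e) (0, z.2), adStarCLM g z.2 z.2)
  have hf : ContDiffAt ℝ 2 f (e, 0) := by
    have h1 : ContDiffAt ℝ 2 (fderiv ℝ (chartMul I G)) (e, e) :=
      (contDiffAt_chartMul I (G := G)).fderiv_right (by
        have : ((2 : WithTop ℕ∞) + 1) = 3 := by norm_num
        rw [this]; exact ENat.LEInfty.out)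
    have h2 : ContDiffAt ℝ 2 (fun z : E × E => fderiv ℝ (chartMul I G) (z.1, e)) (e, 0) :=
      ContDiffAt.comp (g := fderiv ℝ (chartMul I G)) (f := fun z : E × E => (z.1, e)) (e, 0) h1
        (contDiffAt_fst.prodMk contDiffAt_const)
    refine (h2.clm_apply (contDiffAt_const.prodMk contDiffAt_snd)).prodMk ?_
    exact ((adStarCLM g).contDiff.contDiffAt.comp (e, (0 : E)) contDiffAt_snd).clm_apply
      contDiffAt_snd
  have hgood := (continuous_fst.tendsto (e, (0 : E))).eventually
    ((eventually_hasLeftVel I G).and (mdifferentiableAt_oneParam I (G := G)))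
  obtain ⟨ε, hε, δ, hδ, α, hα⟩ := exists_differentiable_flow_of_zero hf
    (by simp only [f, map_zero]; exact Prod.ext (map_zero _) rfl) hgood
  obtain ⟨C, hC, hnorm⟩ := exists_norm_sq_le g
  have hεδ : 0 < ε * δ := mul_pos hε hδ
  -- Energy below (εδ)²/C forces ‖v‖ < εδ, which puts v/ε in the ball of radius δ.
  refine ⟨(ε * δ) ^ 2 / C, by positivity, fun v => oneParam I G (α (e, ε⁻¹ • v) 1).1,
    fun v => ε • (α (e, ε⁻¹ • v) 1).2, fun v hv => ?_⟩
  have hv' : (e, ε⁻¹ • v) ∈ Metric.ball (e, (0 : E)) δ := by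
    rw [lt_div_iff₀ hC] at hv
    have h1 : ‖v‖ < ε * δ := lt_of_pow_lt_pow_left₀ 2 hεδ.le (by linarith [hnorm v])
    rw [Metric.mem_ball, Prod.dist_eq]
    simp only [dist_self, dist_zero_right, norm_smul, norm_inv, Real.norm_eq_abs, abs_of_pos hε]
    rw [max_lt_iff]
    exact ⟨hδ, by rwa [inv_mul_lt_iff₀ hε]⟩
  obtain ⟨h0, h1, h2⟩ := hα _ hv'
  set z := α (e, ε⁻¹ • v) with hz
  have hline : DifferentiableAt ℝ (fun v : E => (e, ε⁻¹ • v)) v := by fun_prop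
  have hend : DifferentiableAt ℝ (fun v : E => α (e, ε⁻¹ • v) 1) v :=
    DifferentiableAt.comp (g := fun w => α w 1) v h2 hline
  refine ⟨⟨fun t => oneParam I G (z t).1, fun t => ε • (z t).2, ⟨fun t ht => ?_, fun t ht => ?_⟩,
    by simp [h0, he], by simp [h0, hε.ne'], rfl, rfl⟩, ?_, ?_⟩
  · refine (h1 t ht).1.1 _ _ _ _ rfl ?_
    have h3 := (hasFDerivAt_fst (𝕜 := ℝ) (p := z t)).comp_hasDerivWithinAt t (h1 t ht).2
    have h4 : ((0 : E), ε • (z t).2) = ε • ((0 : E), (z t).2) := by simp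
    rw [h4, map_smul]
    exact h3
  · have h3 := ((hasFDerivAt_snd (𝕜 := ℝ) (p := z t)).comp_hasDerivWithinAt t
      (h1 t ht).2).fun_const_smul ε
    simpa [f] using h3
  · have h3 : MDifferentiableAt 𝓘(ℝ, E) I (oneParam I G) (z 1).1 :=
      (h1 1 ⟨zero_le_one, le_rfl⟩).1.2
    exact MDifferentiableAt.comp (g := oneParam I G) (f := fun v => (α (e, ε⁻¹ • v) 1).1) v h3
      hend.fst.mdifferentiableAt
  · exact hend.snd.const_smul ε

end LocalExponential

/-! ### The global exponential map and the conjugate point. -/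

section Exponential

open scoped Topology
open Filter

variable {E : Type*} [NormedAddCommGroup E] [NormedSpace ℝ E] [FiniteDimensional ℝ E]
  {H : Type*} [TopologicalSpace H] {I : ModelWithCorners ℝ E H} [I.Boundaryless]
  {G : Type*} [TopologicalSpace G] [ChartedSpace H G] [Group G] [LieGroup I ∞ G]
  {g : InnerProductSpace.Core ℝ (GroupLieAlgebra I G)}

lemma EndsAt.energy_eq {v w : E} {q : G} (h : EndsAt g v q w) :
    innerCLM g w w = innerCLM g v v := by
  obtain ⟨γ, u, hγ, -, rfl, -, rfl⟩ := h
  exact hγ.2.energy_eq ordConnected_Icc ⟨zero_le_one, le_rfl⟩ ⟨le_rfl, zero_le_one⟩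

/-- Running a geodesic for twice the time. -/
lemma EndsAt.double {v w w' : E} {q q' : G} (h : EndsAt g v q w) (h' : EndsAt g w q' w') :
    EndsAt g ((2 : ℝ) • v) (q * q') ((2 : ℝ) • w') := by
  obtain ⟨γ, u, hγ, h1, h2, h3, h4⟩ := h
  obtain ⟨γ', u', hγ', h1', h2', h3', h4'⟩ := h'
  have hm : MapsTo (fun x : ℝ => 1 * x + -1) (Icc 1 2) (Icc 0 1) := fun x hx => by
    constructor <;> linarith [hx.1, hx.2]
  have hshift := (hγ'.comp_affine 1 (-1) hm).const_mul q
  have hglue := hγ.glue zero_le_one one_le_two hshift (by simp [h1', h3]) (by simp [h2', h4])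
  have hm' : MapsTo (fun x : ℝ => 2 * x + 0) (Icc 0 1) (Icc 0 2) := fun x hx => by
    constructor <;> linarith [hx.1, hx.2]
  refine ⟨_, _, hglue.comp_affine 2 0 hm', ?_, ?_, ?_, ?_⟩
  · simp [h1]
  · simp [h2]
  · norm_num [h3']
  · norm_num [h4']

/-- Half the velocity has a quarter of the energy, and energy is conserved, so the given maps apply
both to v/2 and again to the velocity reached at the end of that geodesic. -/
lemma HasSmoothExp.four_mul {R : ℝ} (h : HasSmoothExp g R) : HasSmoothExp g (4 * R) := by
  have : IsTopologicalGroup G := topologicalGroup_of_lieGroup I ∞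
  obtain ⟨Γ, U, hΓ⟩ := h
  refine ⟨fun v => Γ ((2 : ℝ)⁻¹ • v) * Γ (U ((2 : ℝ)⁻¹ • v)),
    fun v => (2 : ℝ) • U (U ((2 : ℝ)⁻¹ • v)), fun v hv => ?_⟩
  obtain ⟨a1, a2, a3⟩ := hΓ ((2 : ℝ)⁻¹ • v) (by
    simp only [map_smul, smul_apply, smul_eq_mul]; linarith)
  obtain ⟨b1, b2, b3⟩ := hΓ (U ((2 : ℝ)⁻¹ • v)) (by
    rw [a1.energy_eq]; simp only [map_smul, smul_apply, smul_eq_mul]; linarith)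
  have hs : DifferentiableAt ℝ (fun v : E => (2 : ℝ)⁻¹ • v) v := by fun_prop
  have hU : DifferentiableAt ℝ (fun v : E => U ((2 : ℝ)⁻¹ • v)) v :=
    DifferentiableAt.comp (g := U) v a3 hs
  refine ⟨?_, ?_, ?_⟩
  · simpa using a1.double b1
  · have c1 : MDifferentiableAt 𝓘(ℝ, E) I (fun v : E => Γ ((2 : ℝ)⁻¹ • v)) v :=
      MDifferentiableAt.comp (g := Γ) (f := fun v : E => (2 : ℝ)⁻¹ • v) v a2 hs.mdifferentiableAt
    have c2 : MDifferentiableAt 𝓘(ℝ, E) I (fun v : E => Γ (U ((2 : ℝ)⁻¹ • v))) v :=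
      MDifferentiableAt.comp (g := Γ) (f := fun v : E => U ((2 : ℝ)⁻¹ • v)) v b2
        hU.mdifferentiableAt
    have c3 : MDifferentiable (I.prod I) I fun q : G × G => q.1 * q.2 :=
      (contMDiff_mul I ∞).mdifferentiable (by simp)
    exact MDifferentiableAt.comp (g := fun q : G × G => q.1 * q.2) v (c3 _) (c1.prodMk c2)
  · exact (DifferentiableAt.comp (g := U) v b3 hU).const_smul (2 : ℝ)

/-- The left-invariant metric is complete, with differentiable exponential map. -/
theorem hasSmoothExp (g : InnerProductSpace.Core ℝ (GroupLieAlgebra I G)) (R : ℝ) :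
    HasSmoothExp g R := by
  obtain ⟨R₀, hR₀, h₀⟩ := exists_hasSmoothExp g
  have hn : ∀ n : ℕ, HasSmoothExp g (4 ^ n * R₀) := fun n => by
    induction n with
    | zero => simpa using h₀
    | succ n ih => rw [pow_succ', mul_assoc]; exact ih.four_mul
  obtain ⟨n, hle⟩ := pow_unbounded_of_one_lt (R / R₀) (by norm_num : (1 : ℝ) < 4)
  obtain ⟨Γ, U, h⟩ := hn n
  exact ⟨Γ, U, fun v hv => h v (hv.trans ((div_lt_iff₀ hR₀).1 hle))⟩

lemma isGeodesicOn_iff_isGeodesic {γ : ℝ → G} {u : ℝ → E} {s : Set ℝ} :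
    IsGeodesicOn g γ u s ↔ IsGeodesic g γ u s :=
  (isGeodesicOn_iff g).trans ⟨fun h => ⟨h.1, h.2⟩, fun h => ⟨h.1, h.2⟩⟩

/-- Left translation carries geodesics from 1 to geodesics from p, and uniqueness makes the choice
in `riemExp` immaterial. -/
lemma riemExp_eq {v w : E} {q : G} (h : EndsAt g v q w) (p : G) :
    riemExp g p (mulInvariantVectorField (v : GroupLieAlgebra I G) p) = p * q := by
  obtain ⟨γ, u, hγ, h1, h2, rfl, rfl⟩ := h
  have hp := hγ.const_mul p
  have hex : ∃ (γ : ℝ → G) (u : ℝ → GroupLieAlgebra I G), IsGeodesicOn g γ u (Icc 0 1) ∧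
      γ 0 = p ∧ mulInvariantVectorField (u 0) p
        = mulInvariantVectorField (v : GroupLieAlgebra I G) p :=
    ⟨_, u, isGeodesicOn_iff_isGeodesic.2 hp, by simp [h1], by rw [h2]⟩
  rw [riemExp, dif_pos hex]
  obtain ⟨u', hu', h3, h4⟩ := hex.choose_spec
  have hu'' : IsGeodesic g hex.choose (show ℝ → E from u') (Icc 0 1) :=
    isGeodesicOn_iff_isGeodesic.1 hu'
  have h5 : u' 0 = v := by
    have := mfderiv_inv_mulInvariantVectorField I p (u' 0)
    rw [h4] at this
    exact this.symm.trans (mfderiv_inv_mulInvariantVectorField I p _)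
  exact (hu''.eqOn ordConnected_Icc hp (a := 0)
    ⟨le_rfl, zero_le_one⟩ (by simp [h1, h3]) (h5.trans h2.symm)).1 ⟨zero_le_one, le_rfl⟩

/-- Left translation of the Lie algebra to the tangent space at `p`. -/
def leftTranslate (I : ModelWithCorners ℝ E H) (p : G) : E →L[ℝ] E := mfderiv I I (p * ·) (1 : G)

/-- Left translation of the tangent space at `p` to the Lie algebra. -/
def leftTranslateBack (I : ModelWithCorners ℝ E H) (p : G) : E →L[ℝ] E := mfderiv I I (p⁻¹ * ·) p

omit [FiniteDimensional ℝ E] [I.Boundaryless] in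
lemma leftTranslateBack_leftTranslate (p : G) (v : E) :
    leftTranslateBack I p (leftTranslate I p v) = v :=
  mfderiv_inv_mulInvariantVectorField I p v

omit [FiniteDimensional ℝ E] [I.Boundaryless] in
lemma leftTranslate_leftTranslateBack (p : G) (w : E) :
    leftTranslate I p (leftTranslateBack I p w) = w := by
  have h := mfderiv_mulLeft_mulLeft I p p⁻¹ p w
  rw [inv_mul_cancel] at h
  refine h.trans ?_
  rw [mul_inv_cancel]
  exact mfderiv_one_mul I p w

/-- The Riemannian exponential map is differentiable. -/
theorem mdifferentiableAt_riemExp (g : InnerProductSpace.Core ℝ (GroupLieAlgebra I G)) (p : G)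
    (w : E) : MDifferentiableAt 𝓘(ℝ, E) I (fun w : E => riemExp g p w) w := by
  obtain ⟨Γ, U, h⟩ := hasSmoothExp g
    (innerCLM g (leftTranslateBack I p w) (leftTranslateBack I p w) + 1)
  have hΓ := (h (leftTranslateBack I p w) (lt_add_one _)).2.1
  have hcont : Continuous fun x : E =>
      innerCLM g (leftTranslateBack I p x) (leftTranslateBack I p x) := by fun_prop
  -- The energy bound exceeds that of `w` by 1, hence holds for all nearby vectors as well.
  have hev : (fun w : E => riemExp g p w) =ᶠ[𝓝 w] fun x => p * Γ (leftTranslateBack I p x) := by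
    filter_upwards [hcont.continuousAt.eventually_lt_const (lt_add_one _)] with x hx
    have h1 := riemExp_eq (h _ hx).1 p
    have h2 := leftTranslate_leftTranslateBack (I := I) p x
    rw [← h1]
    exact congrArg (fun y => riemExp g p y) h2.symm
  refine MDifferentiableAt.congr_of_eventuallyEq ?_ hev
  exact MDifferentiableAt.comp (g := (p * ·)) (f := fun x => Γ (leftTranslateBack I p x)) w
    (mdifferentiableAt_mulLeft I p _)
    (MDifferentiableAt.comp (g := Γ) (f := leftTranslateBack I p) w hΓ
      (leftTranslateBack I p).differentiableAt.mdifferentiableAt)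

/-- Geodesics exist for all positive times. -/
lemma exists_isGeodesic (g : InnerProductSpace.Core ℝ (GroupLieAlgebra I G)) (p : G) (v : E) {T : ℝ}
    (hT : 0 < T) : ∃ (γ : ℝ → G) (u : ℝ → E), IsGeodesic g γ u (Icc 0 T) ∧ γ 0 = p ∧ u 0 = v := by
  obtain ⟨Γ, U, h⟩ := hasSmoothExp g (innerCLM g (T • v) (T • v) + 1)
  obtain ⟨γ, u, hγ, h1, h2, -, -⟩ := (h (T • v) (lt_add_one _)).1
  have hm : MapsTo (fun x : ℝ => T⁻¹ * x + 0) (Icc 0 T) (Icc 0 1) := fun x hx => by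
    change T⁻¹ * x + 0 ∈ Icc 0 1
    rw [add_zero, ← div_eq_inv_mul]
    exact ⟨div_nonneg hx.1 hT.le, (div_le_one hT).2 hx.2⟩
  exact ⟨_, _, (hγ.comp_affine T⁻¹ 0 hm).const_mul p, by simp [h1], by simp [h2, hT.ne']⟩

/-- If right multiplication by `γ(0)⁻¹ γ(τ)` is an isometry, then `γ(s)⁻¹ γ(s + τ)` does not depend
on `s`. -/
lemma IsGeodesic.endsAt_of_isometry {γ : ℝ → G} {u : ℝ → E} {τ : ℝ} (hτ : 0 < τ)
    (hγ : IsGeodesic g γ u (Icc 0 (τ + 1))) {k : G} (hk : γ τ = γ 0 * k)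
    (hiso : ∀ x y, innerCLM g (AdInv I k x) (AdInv I k y) = innerCLM g x y) {s : ℝ}
    (hs : s ∈ Icc (0 : ℝ) 1) : ∃ w, EndsAt g (τ • u s) k w := by
  have hmem : τ ∈ Icc 0 (τ + 1) := ⟨hτ.le, by linarith⟩
  have hmem0 : (0 : ℝ) ∈ Icc 0 (τ + 1) := ⟨le_rfl, by linarith⟩
  -- Conservation of momentum tested on Ad_{γ(τ)} w: g(u(τ), w) = g(u(0), Ad_k w), and orthogonality
  -- moves Ad_k to the other side.
  have huτ : u τ = AdInv I k (u 0) := by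
    refine innerCLM_ext g fun w => ?_
    have h1 := momentum_eq ordConnected_Icc hγ.1 hγ.2 (AdInv I (γ τ)⁻¹ w) hmem hmem0
    rw [AdInv_apply_inv] at h1
    have h2 : AdInv I (γ 0) (AdInv I (γ τ)⁻¹ w) = AdInv I k⁻¹ w := by
      rw [← AdInv_mul_apply, hk]; congr 2; group
    rw [h1, h2, ← hiso, AdInv_apply_inv]
  have hm1 : MapsTo (fun x : ℝ => 1 * x + τ) (Icc 0 1) (Icc 0 (τ + 1)) := fun x hx => by
    constructor <;> linarith [hx.1, hx.2]
  -- Uniqueness applied to t ↦ γ(t + τ) and t ↦ γ(t)k.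
  have heq := ((hγ.comp_affine 1 τ hm1).eqOn ordConnected_Icc
    ((hγ.mono (Icc_subset_Icc_right (by linarith))).mul_const hiso) (a := 0)
    ⟨le_rfl, zero_le_one⟩ (by simp [hk]) (by simp [huτ])).1 hs
  have hm2 : MapsTo (fun x : ℝ => τ * x + s) (Icc 0 1) (Icc 0 (τ + 1)) := fun x hx => by
    constructor <;> nlinarith [hx.1, hx.2, hs.1, hs.2]
  -- The witness is x ↦ γ(s)⁻¹γ(τx + s), which runs from 1 to γ(s)⁻¹γ(s + τ) = k.
  refine ⟨_, _, _, (hγ.comp_affine τ s hm2).const_mul (γ s)⁻¹, by simp, by simp, ?_, rfl⟩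
  simp only [one_mul] at heq
  simp only [mul_one, add_comm τ s, heq, inv_mul_cancel_left]

omit [FiniteDimensional ℝ E] [I.Boundaryless] [Group G] [LieGroup I ∞ G] in
/-- If `F` is constant along a curve, its differential vanishes on the velocity of the curve. -/
lemma apply_deriv_eq_zero_of_const {F : E → G} {w : E} {L : E →L[ℝ] TangentSpace I (F w)}
    (hL : HasMFDerivAt 𝓘(ℝ, E) I F w L) {c : ℝ → E} {c' : E}
    (hc : HasDerivWithinAt c c' (Icc 0 1) 0) (hw : c 0 = w) {q : G}
    (hconst : ∀ s ∈ Icc (0 : ℝ) 1, F (c s) = q) : L c' = 0 := by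
  subst hw
  have h01 : (0 : ℝ) ∈ Icc (0 : ℝ) 1 := ⟨le_rfl, zero_le_one⟩
  have h1 := HasMFDerivAt.comp_hasMFDerivWithinAt 0 hL hc.hasFDerivWithinAt.hasMFDerivWithinAt
  have hq : q = F (c 0) := (hconst 0 h01).symm
  subst hq
  have h2 := (hasMFDerivWithinAt_const (I := 𝓘(ℝ, ℝ)) (I' := I) (F (c 0)) (Icc (0 : ℝ) 1)
    (0 : ℝ)).congr_mono (f₁ := F ∘ c) (fun s hs => hconst s hs) rfl Subset.rfl
  -- At the endpoint 0 the derivative is one-sided, but the interval still determines it uniquely.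
  have h3 : UniqueMDiffWithinAt 𝓘(ℝ, ℝ) (Icc (0 : ℝ) 1) 0 :=
    (uniqueDiffOn_Icc_zero_one 0 h01).uniqueMDiffWithinAt
  have h4 := DFunLike.congr_fun (h3.eq h1 h2) (1 : ℝ)
  have h5 : L ((1 : ℝ) • c') = 0 := h4
  rwa [one_smul] at h5

/-- The conjugacy theorem for a geodesic in terms of the chart at the identity. -/
theorem IsGeodesic.isConjugateAlong {J : Set ℝ} (hJ : J.OrdConnected) (h0 : (0 : ℝ) ∈ J)
    {γ : ℝ → G} {u : ℝ → E} (hγ : IsGeodesic g γ u J) (hu : ∃ s ∈ J, ∃ t ∈ J, u s ≠ u t) {τ : ℝ}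
    (hτ : 0 < τ) (hτJ : τ ∈ J) (hiso : IsRightIsometry g ((γ 0)⁻¹ * γ τ)) :
    IsConjugateAlong g γ u τ := by
  set k := (γ 0)⁻¹ * γ τ with hk
  have hiso' : ∀ x y, innerCLM g (AdInv I k x) (AdInv I k y) = innerCLM g x y :=
    fun x y => hiso.inner_AdInv I x y
  -- The interval J may end at τ, while times up to τ + 1 are needed. A geodesic with the same
  -- initial data exists on [0, τ + 1] and agrees with γ up to τ.
  obtain ⟨η, ν, hη, hη0, hν0⟩ := exists_isGeodesic g (γ 0) (u 0) (T := τ + 1) (by linarith)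
  have hητ : η τ = γ τ :=
    ((hη.mono (Icc_subset_Icc_right (by linarith))).eqOn ordConnected_Icc
      (hγ.mono (hJ.out h0 hτJ)) (a := 0) ⟨le_rfl, hτ.le⟩ hη0 hν0).1 ⟨hτ.le, le_rfl⟩
  have hends : ∀ s ∈ Icc (0 : ℝ) 1, riemExp g (γ 0)
      (leftTranslate I (γ 0) (τ • ν s) : E) = γ τ := fun s hs => by
    obtain ⟨w, hw⟩ := hη.endsAt_of_isometry hτ (k := k) (by rw [hητ, hη0, hk]; group) hiso' hs
    refine (riemExp_eq hw (γ 0)).trans ?_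
    rw [hk, mul_inv_cancel_left]
  have h01 : (0 : ℝ) ∈ Icc (0 : ℝ) 1 := ⟨le_rfl, zero_le_one⟩
  set p := γ 0 with hp
  have hpt : (τ • (mulInvariantVectorField (u 0 : GroupLieAlgebra I G) p : TangentSpace I p) : E)
      = leftTranslate I p (τ • ν 0) := by
    rw [hν0, map_smul]; rfl
  refine ⟨(congrArg (fun y => riemExp g p y) hpt).trans (hends 0 h01), ?_⟩
  have hL := (mdifferentiableAt_riemExp g p
    (τ • (mulInvariantVectorField (u 0 : GroupLieAlgebra I G) p : TangentSpace I p))).hasMFDerivAt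
  refine ⟨_, hL, fun hinj => ?_⟩
  -- The velocity at s = 0 of the curve s ↦ γ(0) τν(s), on which the exponential map is constant; it
  -- is the candidate kernel vector.
  have hc : HasDerivWithinAt (fun s => leftTranslate I p (τ • ν s))
      (leftTranslate I p (τ • adStarCLM g (ν 0) (ν 0))) (Icc 0 1) 0 :=
    (leftTranslate I p).hasFDerivAt.comp_hasDerivWithinAt 0
      (((hη.2.mono (Icc_subset_Icc_right (by linarith))) 0 h01).fun_const_smul τ)
  have hzero := apply_deriv_eq_zero_of_const hL hc hpt.symm hends
  have hzero' := congrArg (leftTranslateBack I p) (hinj (hzero.trans (map_zero _).symm))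
  have hvel : adStarCLM g (u 0) (u 0) = 0 := by
    have h1 : leftTranslateBack I p (leftTranslate I p (τ • adStarCLM g (ν 0) (ν 0))) = 0 :=
      hzero'.trans (map_zero _)
    rw [leftTranslateBack_leftTranslate, hν0, smul_eq_zero] at h1
    exact h1.resolve_left hτ.ne'
  -- If the kernel vector vanishes, u(0) is an equilibrium, so u is constant on all of J, against
  -- the hypothesis.
  have hconst : IsEulerOn g (fun _ => u 0) J := fun t _ => by
    simpa [hvel] using hasDerivWithinAt_const t J (u 0)
  have hEq := hγ.2.eqOn hJ hconst h0 rfl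
  obtain ⟨s, hs, t, ht, hst⟩ := hu
  exact hst ((hEq hs).trans (hEq ht).symm)

end Exponential

end LeftInvariant

end

theorem mainTheorem1
    {E : Type*} [NormedAddCommGroup E] [NormedSpace ℝ E] [FiniteDimensional ℝ E]
    {H : Type*} [TopologicalSpace H] {I : ModelWithCorners ℝ E H} [I.Boundaryless]
    {G : Type*} [TopologicalSpace G] [T2Space G] [ChartedSpace H G] [Group G] [LieGroup I ∞ G]
    (g : InnerProductSpace.Core ℝ (GroupLieAlgebra I G))
    {J : Set ℝ} (hJ : J.OrdConnected) (h0 : (0 : ℝ) ∈ J)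
    {γ : ℝ → G} {u : ℝ → GroupLieAlgebra I G}
    (hγ : LeftInvariant.IsGeodesicOn g γ u J)
    (hu : ∃ s ∈ J, ∃ t ∈ J, u s ≠ u t)
    {τ : ℝ} (hτ : 0 < τ) (hτJ : τ ∈ J) :
    (LeftInvariant.IsRightIsometry g ((γ 0)⁻¹ * γ τ) →
      LeftInvariant.IsConjugateAlong g γ u τ) ∧
    (γ τ = γ 0 → LeftInvariant.IsConjugateAlong g γ u τ) := by
  have h : LeftInvariant.IsRightIsometry g ((γ 0)⁻¹ * γ τ) →
      LeftInvariant.IsConjugateAlong g γ u τ :=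
    LeftInvariant.IsGeodesic.isConjugateAlong hJ h0
      (LeftInvariant.isGeodesicOn_iff_isGeodesic.1 hγ) hu hτ hτJ
  refine ⟨h, fun hclosed => h ?_⟩
  -- For a closed geodesic the right multiplier is 1.
  rw [hclosed, inv_mul_cancel]
  exact LeftInvariant.isRightIsometry_one I g
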